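/- Let $s\in(0,1)$, let $n\ge 1$ be an integer with $n>2s$, let $\Omega\subset\mathbb R^n$ be a nonempty bounded open set, and put $2^*:=\frac{2n}{n-2s}$ and $\Omega^c:=\mathbb R^n\setminus\Omega$. Let $K:\mathbb R^n\setminus\{0\}\to(0,+\infty)$ be such that $x\mapsto\min\{|x|^2,1\}K(x)$ belongs to $L^1(\mathbb R^n)$ and, for some $k_0>0$, $K(x)\ge k_0|x|^{-(n+2s)}$ for all $x\ne 0$. Write $Q:=\mathbb R^{2n}\setminus(\Omega^c\times\Omega^c)$ and let $X_0$ be the space of Lebesgue measurable functions $u:\mathbb R^n\to\mathbb R$ (identified when equal a.e.) with $u|_\Omega\in L^2(\Omega)$, $u=0$ a.e. in $\Omega^c$ and $(u(x)-u(y))\sqrt{K(x-y)}\in L^2(Q,dx\,dy)$, with scalar product and norm $$\langle u,v\rangle:=\int_Q(u(x)-u(y))(v(x)-v(y))K(x-y)\,dx\,dy,\qquad \|u\|:=\langle u,u\rangle^{1/2}.$$ Let $$c_{2^*}:=\sup_{u\in X_0\setminus\{0\}}\frac{\|u\|_{L^{2^*}(\mathbb R^n)}}{\|u\|}.$$ Let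 $g:\mathbb R\to\mathbb R$ be continuous, let $G(t):=\int_0^t g(\tau)\,d\tau$, and assume that there are $a_1,a_2>0$ and $q\in[1,2^*)$ such that $|g(t)|\le a_1+a_2|t|^{q-1}$ for all $t\in\mathbb R$, and that $\liminf_{t\to0^+}G(t)/t^2=+\infty$. For $\mu>0$ and $t\ge 0$ put $$h_\mu(t):=\frac{t-\mu c_{2^*}^{2^*}t^{2^*-1}}{a_1c_{2^*}|\Omega|^{\frac{2^*-1}{2^*}}+a_2c_{2^*}^q|\Omega|^{\frac{2^*-q}{2^*}}t^{q-1}}.$$ Then $c_{2^*}<+\infty$, and for every $\mu>0$ the function $h_\mu$ attains its maximum on $[0,+\infty)$ and there is a nonempty open interval $\Lambda_\mu\subseteq\left(0,\max_{[0,+\infty)}h_\mu\right)$ such that, for every $\lambda\in\Lambda_\mu$, the problem $$-\mathcal L_Ku=\mu|u|^{2^*-2}u+\lambda g(u)\ \text{ in }\Omega,\qquad u=0\ \text{ in }\mathbb R^n\setminus\Omega,$$ where $\mathcal L_Ku(x)=\int_{\mathbb R^n}(u(x+y)+u(x-y)-2u(x))K(y)\,dy$, has a non-trivial weak solution in $X_0$,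 that is, some $u\in X_0$, $u\ne0$, such that for every $v\in X_0$ all the integrals below exist and $$\langle u,v\rangle-\mu\int_\Omega|u|^{2^*-2}uv\,dx-\lambda\int_\Omega g(u)v\,dx=0 .$$ Moreover $u$ can be chosen to be a local minimizer of the energy $$\mathcal E_{\lambda,\mu}(w):=\frac12\|w\|^2-\frac{\mu}{2^*}\int_\Omega|w|^{2^*}dx-\lambda\int_\Omega G(w)\,dx,\qquad w\in X_0,$$ in a small ball: there is $\rho$ with $0<\rho<\left(\frac{n}{(n-2s)\,c_{2^*}^{2^*}\,\mu}\right)^{\frac{n-2s}{4s}}$ such that $\|u\|<\rho$ and $\mathcal E_{\lambda,\mu}(u)\le\mathcal E_{\lambda,\mu}(v)$ for every $v\in X_0$ with $\|v\|\le\rho$. -/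

import Mathlib

open MeasureTheory Set Filter Topology
open scoped ENNReal

noncomputable section

namespace NonlocalCritical

/-- The fractional critical exponent `2^* = 2n / (n - 2s)`. -/
def twoStar (n : ℕ) (s : ℝ) : ℝ := 2 * n / (n - 2 * s)

/-- `Q = ℝ²ⁿ \ (Ωᶜ × Ωᶜ)`. -/
def Q {n : ℕ} (Ω : Set (EuclideanSpace ℝ (Fin n))) :
    Set (EuclideanSpace ℝ (Fin n) × EuclideanSpace ℝ (Fin n)) :=
  (Ωᶜ ×ˢ Ωᶜ)ᶜ

/-- The space `X`: Lebesgue measurable functions `u` with `u|_Ω ∈ L²(Ω)` and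
`(x, y) ↦ (u x - u y) √K(x - y)` in `L²(Q, dx dy)`. Elements are functions, to be identified when
they agree almost everywhere. -/
def X {n : ℕ} (K : EuclideanSpace ℝ (Fin n) → ℝ) (Ω : Set (EuclideanSpace ℝ (Fin n))) :
    Set (EuclideanSpace ℝ (Fin n) → ℝ) :=
  {u | AEMeasurable u volume ∧ MemLp u 2 (volume.restrict Ω) ∧
    MemLp (fun p : EuclideanSpace ℝ (Fin n) × EuclideanSpace ℝ (Fin n) =>
      (u p.1 - u p.2) * √(K (p.1 - p.2))) 2 (volume.restrict (Q Ω))}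

/-- The space `X₀` of those `u ∈ X` that vanish almost everywhere outside `Ω`. -/
def X₀ {n : ℕ} (K : EuclideanSpace ℝ (Fin n) → ℝ) (Ω : Set (EuclideanSpace ℝ (Fin n))) :
    Set (EuclideanSpace ℝ (Fin n) → ℝ) :=
  {u | u ∈ X K Ω ∧ ∀ᵐ x ∂volume, x ∈ Ωᶜ → u x = 0}

/-- The scalar product `⟨u, v⟩ = ∫_Q (u x - u y) (v x - v y) K(x - y) dx dy` of `X₀`. -/
def scalarProd {n : ℕ} (K : EuclideanSpace ℝ (Fin n) → ℝ) (Ω : Set (EuclideanSpace ℝ (Fin n)))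
    (u v : EuclideanSpace ℝ (Fin n) → ℝ) : ℝ :=
  ∫ p in Q Ω, (u p.1 - u p.2) * (v p.1 - v p.2) * K (p.1 - p.2)

/-- The norm `‖u‖ = (∫_Q |u x - u y|² K(x - y) dx dy)^{1/2}` of `X₀`. -/
def normX₀ {n : ℕ} (K : EuclideanSpace ℝ (Fin n) → ℝ) (Ω : Set (EuclideanSpace ℝ (Fin n)))
    (u : EuclideanSpace ℝ (Fin n) → ℝ) : ℝ :=
  √(∫ p in Q Ω, |u p.1 - u p.2| ^ 2 * K (p.1 - p.2))

/-- The best constant of the embedding `X₀ ↪ L^p(ℝⁿ)`, as an extended nonnegative number: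
the supremum of `‖u‖_{L^p(ℝⁿ)} / ‖u‖` over all `u ∈ X₀` that are not a.e. zero. -/
def embConstENN {n : ℕ} (K : EuclideanSpace ℝ (Fin n) → ℝ) (Ω : Set (EuclideanSpace ℝ (Fin n)))
    (p : ℝ) : ℝ≥0∞ :=
  ⨆ u ∈ {u | u ∈ X₀ K Ω ∧ ¬ u =ᵐ[volume] 0},
    eLpNorm u (ENNReal.ofReal p) volume / ENNReal.ofReal (normX₀ K Ω u)

/-- The best constant `c_p` of the embedding `X₀ ↪ L^p(ℝⁿ)`, as a real number. -/
def embConst {n : ℕ} (K : EuclideanSpace ℝ (Fin n) → ℝ) (Ω : Set (EuclideanSpace ℝ (Fin n)))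
    (p : ℝ) : ℝ :=
  (embConstENN K Ω p).toReal

/-- The primitive `G(t) = ∫₀ᵗ g`. -/
def primitive (g : ℝ → ℝ) (t : ℝ) : ℝ := ∫ τ in (0 : ℝ)..t, g τ

/-- The energy
`u ↦ ½ ‖u‖² - (μ / 2^*) ∫_Ω |u|^{2^*} dx - lam ∫_Ω G(u) dx`. -/
def energy {n : ℕ} (s : ℝ) (K : EuclideanSpace ℝ (Fin n) → ℝ)
    (Ω : Set (EuclideanSpace ℝ (Fin n))) (g : ℝ → ℝ) (lam μ : ℝ)
    (u : EuclideanSpace ℝ (Fin n) → ℝ) : ℝ :=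
  1 / 2 * normX₀ K Ω u ^ 2 - μ / twoStar n s * (∫ x in Ω, |u x| ^ twoStar n s)
    - lam * ∫ x in Ω, primitive g (u x)

/-- `u` is a weak solution of `-L_K u = μ |u|^{2^*-2} u + lam g(u)` in `Ω`, `u = 0` outside `Ω`:
`u ∈ X₀` and, for every `v ∈ X₀`, the integrals of the weak formulation exist and
`⟨u, v⟩ - μ ∫_Ω |u|^{2^*-2} u v dx - lam ∫_Ω g(u) v dx = 0`. -/
def IsWeakSolution {n : ℕ} (s : ℝ) (K : EuclideanSpace ℝ (Fin n) → ℝ)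
    (Ω : Set (EuclideanSpace ℝ (Fin n))) (g : ℝ → ℝ) (lam μ : ℝ)
    (u : EuclideanSpace ℝ (Fin n) → ℝ) : Prop :=
  u ∈ X₀ K Ω ∧ ∀ v ∈ X₀ K Ω,
    IntegrableOn (fun p : EuclideanSpace ℝ (Fin n) × EuclideanSpace ℝ (Fin n) =>
      (u p.1 - u p.2) * (v p.1 - v p.2) * K (p.1 - p.2)) (Q Ω) ∧
    IntegrableOn (fun x => |u x| ^ (twoStar n s - 2) * u x * v x) Ω ∧
    IntegrableOn (fun x => g (u x) * v x) Ω ∧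
    scalarProd K Ω u v - μ * (∫ x in Ω, |u x| ^ (twoStar n s - 2) * u x * v x)
      - lam * (∫ x in Ω, g (u x) * v x) = 0

/-- The rational function `h_μ`, with `c = c_{2^*}`:
`h_μ(t) = (t - μ c^{2^*} t^{2^*-1}) /
  (a₁ c |Ω|^{(2^*-1)/2^*} + a₂ c^q |Ω|^{(2^*-q)/2^*} t^{q-1})`. -/
def h {n : ℕ} (s : ℝ) (K : EuclideanSpace ℝ (Fin n) → ℝ) (Ω : Set (EuclideanSpace ℝ (Fin n)))
    (a₁ a₂ q μ t : ℝ) : ℝ :=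
  (t - μ * embConst K Ω (twoStar n s) ^ twoStar n s * t ^ (twoStar n s - 1)) /
    (a₁ * embConst K Ω (twoStar n s) * volume.real Ω ^ ((twoStar n s - 1) / twoStar n s) +
      a₂ * embConst K Ω (twoStar n s) ^ q * volume.real Ω ^ ((twoStar n s - q) / twoStar n s) *
        t ^ (q - 1))

/-- The radius `(n / ((n - 2s) c_{2^*}^{2^*} μ))^{(n-2s)/(4s)}`. -/
def smallRadius {n : ℕ} (s : ℝ) (K : EuclideanSpace ℝ (Fin n) → ℝ)
    (Ω : Set (EuclideanSpace ℝ (Fin n))) (μ : ℝ) : ℝ :=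
  (n / ((n - 2 * s) * embConst K Ω (twoStar n s) ^ twoStar n s * μ)) ^ ((n - 2 * s) / (4 * s))

end NonlocalCritical

end

/-! The solution is a minimizer of the energy on a small closed ball of `X₀`, shown to lie in the
open ball and to have negative energy. The critical embedding is not compact, so the direct method
needs a substitute for weak continuity of the critical term. It comes from convexity: by the
parallelogram law, ½‖·‖² gains ‖u - v‖²/8 at midpoints, while the critical term loses at most a
constant times ρ^{2^*-2}‖u - v‖² on the ball of radius ρ (`Admissible.exists_midpoint_le`). For
small ρ the gain wins. The subcritical term is controlled by the L¹(Ω) distance up to an arbitrarily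
small error, so a minimizing sequence that converges in L¹(Ω) is Cauchy in norm
(`Admissible.eventually_normX₀_sub_sq_le`, `Admissible.eventually_exists_minimizer`).

Two embeddings are proved from scratch. The Sobolev inequality compares u(x) with its values on a
ball around x and optimizes the radius at each point; `eLpNorm_sq_le_gagliardo` results after
integration and truncation. Compactness in L²(Ω) follows because averages over r-balls approximate u
uniformly on bounded sets of `X₀` as r → 0, and weak convergence makes the averages converge
pointwise (`Admissible.exists_subseq_cauchy`).

On the sphere of radius ρ the energy is positive once lam is small, whereas the superquadratic
behaviour of `primitive g` at 0⁺ makes it negative somewhere in the ball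
(`Admissible.exists_energy_neg`). So the minimizer is interior and nonzero, and differentiating
along lines gives the equation. The function `h` matters only through the positivity of its maximum,
at which the interval (0, ρ²/(4M)) is cut off. -/

namespace NonlocalCritical

/-! ### The critical exponent. -/

section Exponents

variable {n : ℕ} {s : ℝ}

lemma twoStar_pos (hs0 : 0 < s) (hns : 2 * s < n) : 0 < twoStar n s :=
  div_pos (by linarith) (by linarith)

lemma two_lt_twoStar (hs0 : 0 < s) (hns : 2 * s < n) : 2 < twoStar n s := by
  rw [twoStar, lt_div_iff₀ (by linarith)]; linarith

end Exponents

/-! ### Fractional Sobolev inequality. -/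

section Sobolev

variable {n : ℕ} {s : ℝ}

/-- Volume of the unit ball. -/
noncomputable def unitBallVol (n : ℕ) : ℝ :=
  volume.real (Metric.ball (0 : EuclideanSpace ℝ (Fin n)) 1)

lemma unitBallVol_pos (n : ℕ) : 0 < unitBallVol n :=
  ENNReal.toReal_pos (Metric.measure_ball_pos _ _ one_pos).ne' measure_ball_lt_top.ne

lemma volume_ball_eq (x : EuclideanSpace ℝ (Fin n)) {r : ℝ} (hr : 0 < r) :
    volume (Metric.ball x r) = ENNReal.ofReal (r ^ n * unitBallVol n) := by
  rw [Measure.addHaar_ball_of_pos _ _ hr, ENNReal.ofReal_mul (by positivity), unitBallVol,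
    ofReal_measureReal measure_ball_lt_top.ne]
  simp

/-- The squared Gagliardo difference quotient, integrated in one variable. -/
noncomputable def gagliardoAt (s : ℝ) (u : EuclideanSpace ℝ (Fin n) → ℝ)
    (x : EuclideanSpace ℝ (Fin n)) : ℝ≥0∞ :=
  ∫⁻ y, ‖u x - u y‖ₑ ^ 2 * (ENNReal.ofReal (‖x - y‖ ^ ((n : ℝ) + 2 * s)))⁻¹

/-- On the ball the Gagliardo weight is at least r^{-(n+2s)}; dividing by the volume of the ball
leaves r^{2s}. Normalizing the measure by `ProbabilityTheory.cond` makes later comparisons of Lᵖ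
norms free of constants. -/
lemma lintegral_cond_ball_sub_le (hs0 : 0 < s) (u : EuclideanSpace ℝ (Fin n) → ℝ)
    (x : EuclideanSpace ℝ (Fin n)) {r : ℝ} (hr : 0 < r) :
    ∫⁻ y, ‖u x - u y‖ₑ ^ 2 ∂(ProbabilityTheory.cond volume (Metric.ball x r)) ≤
      ENNReal.ofReal ((unitBallVol n)⁻¹ * r ^ (2 * s)) * gagliardoAt s u x := by
  have hω := unitBallVol_pos n
  have h1 : ∫⁻ y in Metric.ball x r, ‖u x - u y‖ₑ ^ 2 ≤
      ENNReal.ofReal (r ^ ((n : ℝ) + 2 * s)) * gagliardoAt s u x := by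
    rw [gagliardoAt, ← lintegral_const_mul' _ _ ENNReal.ofReal_ne_top]
    refine (setLIntegral_mono' measurableSet_ball fun y hy => ?_).trans
      (setLIntegral_le_lintegral _ _)
    by_cases hxy : x = y
    · simp [hxy]
    have hpos : 0 < ‖x - y‖ := norm_pos_iff.2 (sub_ne_zero.2 hxy)
    have hle : ‖x - y‖ ^ ((n : ℝ) + 2 * s) ≤ r ^ ((n : ℝ) + 2 * s) := by
      apply Real.rpow_le_rpow hpos.le _ (by positivity)
      rw [← dist_eq_norm, dist_comm]; exact (Metric.mem_ball.1 hy).le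
    have h2 : (1 : ℝ≥0∞) ≤ ENNReal.ofReal (r ^ ((n : ℝ) + 2 * s)) *
        (ENNReal.ofReal (‖x - y‖ ^ ((n : ℝ) + 2 * s)))⁻¹ := by
      rw [← div_eq_mul_inv, ENNReal.le_div_iff_mul_le (Or.inl (by positivity)) (Or.inl (by simp)),
        one_mul]
      exact ENNReal.ofReal_le_ofReal hle
    calc ‖u x - u y‖ₑ ^ 2 = ‖u x - u y‖ₑ ^ 2 * 1 := (mul_one _).symm
      _ ≤ ‖u x - u y‖ₑ ^ 2 * (ENNReal.ofReal (r ^ ((n : ℝ) + 2 * s)) *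
        (ENNReal.ofReal (‖x - y‖ ^ ((n : ℝ) + 2 * s)))⁻¹) := by gcongr
      _ = _ := by ring
  rw [ProbabilityTheory.cond, lintegral_smul_measure, smul_eq_mul, volume_ball_eq x hr,
    ← ENNReal.ofReal_inv_of_pos (by positivity)]
  refine (mul_le_mul_right h1 _).trans_eq ?_
  rw [← mul_assoc, ← ENNReal.ofReal_mul (by positivity), Real.rpow_add hr, Real.rpow_natCast]
  congr 2
  field_simp

instance (x : EuclideanSpace ℝ (Fin n)) (r : ℝ) [Fact (0 < r)] :
    IsProbabilityMeasure
      (ProbabilityTheory.cond (volume : Measure (EuclideanSpace ℝ (Fin n))) (Metric.ball x r)) :=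
  ProbabilityTheory.cond_isProbabilityMeasure_of_finite
    (Metric.measure_ball_pos _ _ Fact.out).ne' measure_ball_lt_top.ne

lemma aestronglyMeasurable_cond {u : EuclideanSpace ℝ (Fin n) → ℝ} (hu : AEMeasurable u volume)
    (A : Set (EuclideanSpace ℝ (Fin n))) :
    AEStronglyMeasurable u (ProbabilityTheory.cond volume A) :=
  hu.aestronglyMeasurable.mono_ac (ProbabilityTheory.cond_absolutelyContinuous)

lemma eLpNorm_one_cond_ball_sub_le (hs0 : 0 < s) {u : EuclideanSpace ℝ (Fin n) → ℝ}
    (hu : AEMeasurable u volume) (x : EuclideanSpace ℝ (Fin n)) {r : ℝ} (hr : 0 < r) :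
    eLpNorm (fun y => u x - u y) 1 (ProbabilityTheory.cond volume (Metric.ball x r)) ≤
      (ENNReal.ofReal ((unitBallVol n)⁻¹ * r ^ (2 * s)) * gagliardoAt s u x) ^ (1 / 2 : ℝ) := by
  have : Fact (0 < r) := ⟨hr⟩
  have hm := aestronglyMeasurable_cond hu (Metric.ball x r)
  refine (eLpNorm_le_eLpNorm_of_exponent_le (q := 2) (by norm_num) (aestronglyMeasurable_const.sub hm)).trans ?_
  rw [eLpNorm_eq_lintegral_rpow_enorm_toReal (by norm_num) (by norm_num)]
  simp only [ENNReal.toReal_ofNat]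
  gcongr
  refine le_trans (le_of_eq ?_) (lintegral_cond_ball_sub_le hs0 u x hr)
  exact lintegral_congr fun y => by norm_cast

/-- Average the identity u(x) = (u(x) - u(y)) + u(y) over the ball: Cauchy–Schwarz bounds the first
part, Hölder the second. The first bound grows with r and the second decays, which leaves r to be
optimized. -/
lemma enorm_le_add_of_ball (hs0 : 0 < s) {u : EuclideanSpace ℝ (Fin n) → ℝ}
    (hu : AEMeasurable u volume) (x : EuclideanSpace ℝ (Fin n)) {r : ℝ} (hr : 0 < r)
    {p : ℝ} (hp : 1 ≤ p) :
    ‖u x‖ₑ ≤ (ENNReal.ofReal ((unitBallVol n)⁻¹ * r ^ (2 * s)) * gagliardoAt s u x) ^ (1 / 2 : ℝ) +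
      ENNReal.ofReal ((r ^ n * unitBallVol n)⁻¹ ^ (1 / p)) *
        eLpNorm u (ENNReal.ofReal p) volume := by
  have : Fact (0 < r) := ⟨hr⟩
  have hω := unitBallVol_pos n
  set ν := ProbabilityTheory.cond volume (Metric.ball x r) with hν
  have hm : AEStronglyMeasurable u ν := aestronglyMeasurable_cond hu _
  have h0 : ‖u x‖ₑ = eLpNorm (fun _ => u x) 1 ν := by
    rw [eLpNorm_const _ one_ne_zero (IsProbabilityMeasure.ne_zero ν)]; simp
  have h1 : (fun _ : EuclideanSpace ℝ (Fin n) => u x) = (fun y => u x - u y) + u := by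
    ext y; simp
  rw [h0, h1]
  refine (eLpNorm_add_le (aestronglyMeasurable_const.sub hm) hm le_rfl).trans ?_
  refine add_le_add (eLpNorm_one_cond_ball_sub_le hs0 hu x hr) ?_
  refine (eLpNorm_le_eLpNorm_of_exponent_le (q := ENNReal.ofReal p) (by simpa using hp) hm).trans ?_
  rw [hν, ProbabilityTheory.cond, eLpNorm_smul_measure_of_ne_zero (by simp [measure_ball_lt_top.ne]),
    smul_eq_mul, volume_ball_eq x hr, ← ENNReal.ofReal_inv_of_pos (by positivity),
    ENNReal.toReal_div, ENNReal.toReal_one, ENNReal.toReal_ofReal (by linarith),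
    ENNReal.ofReal_rpow_of_nonneg (by positivity) (by positivity)]
  gcongr
  exact Measure.restrict_le_self

/-- Optimization in the radius. Since 1/2^* = 1/2 - s/n, the choice r^n = N²/Y makes both terms
multiples of N^{(p-2)/p} Y^{1/p}, where p = 2^*. -/
lemma rpow_le_of_forall_radius (hs0 : 0 < s) (hns : 2 * s < n) {ω a Y N : ℝ} (hω : 0 < ω)
    (ha : 0 ≤ a) (hY : 0 < Y) (hN : 0 < N)
    (H : ∀ r : ℝ, 0 < r → a ≤ (ω⁻¹ * r ^ (2 * s) * Y) ^ (1 / 2 : ℝ) +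
      (r ^ n * ω)⁻¹ ^ (1 / twoStar n s) * N) :
    a ^ twoStar n s ≤ (ω⁻¹ ^ (1 / 2 : ℝ) + ω⁻¹ ^ (1 / twoStar n s)) ^ twoStar n s *
      N ^ (twoStar n s - 2) * Y := by
  have hn : (0 : ℝ) < n := by linarith
  have hn2 : (n : ℝ) - 2 * s ≠ 0 := by linarith
  have hp := twoStar_pos hs0 hns
  set p := twoStar n s with hpdef
  obtain ⟨y, rfl⟩ : ∃ y, Y = Real.exp y := ⟨_, (Real.exp_log hY).symm⟩
  obtain ⟨m, rfl⟩ : ∃ m, N = Real.exp m := ⟨_, (Real.exp_log hN).symm⟩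
  -- This is r = (N²/Y)^{1/n}; in logarithmic variables the exponents become linear.
  have h := H (Real.exp ((2 * m - y) / n)) (Real.exp_pos _)
  have e1 : (ω⁻¹ * Real.exp ((2 * m - y) / n) ^ (2 * s) * Real.exp y) ^ (1 / 2 : ℝ) =
      ω⁻¹ ^ (1 / 2 : ℝ) * Real.exp (((p - 2) * m + y) / p) := by
    rw [mul_assoc, Real.mul_rpow (by positivity) (by positivity), ← Real.exp_mul, ← Real.exp_add,
      ← Real.exp_mul]
    congr 2
    rw [hpdef, twoStar]; field_simp; ring
  have e2 : (Real.exp ((2 * m - y) / n) ^ n * ω)⁻¹ ^ (1 / p) * Real.exp m =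
      ω⁻¹ ^ (1 / p) * Real.exp (((p - 2) * m + y) / p) := by
    rw [mul_comm (_ ^ n), mul_inv, Real.mul_rpow (by positivity) (by positivity), ← Real.exp_nat_mul,
      ← Real.exp_neg, ← Real.exp_mul, mul_assoc, ← Real.exp_add]
    congr 2
    rw [hpdef, twoStar]; field_simp; ring
  rw [e1, e2, ← add_mul] at h
  refine (Real.rpow_le_rpow ha h hp.le).trans_eq ?_
  rw [Real.mul_rpow (by positivity) (by positivity), ← Real.exp_mul, ← Real.exp_mul, mul_assoc,
    ← Real.exp_add]
  congr 2
  field_simp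

lemma enorm_rpow_le_gagliardoAt (hs0 : 0 < s) (hns : 2 * s < n)
    {u : EuclideanSpace ℝ (Fin n) → ℝ} (hu : AEMeasurable u volume)
    (hN : eLpNorm u (ENNReal.ofReal (twoStar n s)) volume ≠ ∞)
    (hN0 : eLpNorm u (ENNReal.ofReal (twoStar n s)) volume ≠ 0) (x : EuclideanSpace ℝ (Fin n)) :
    ‖u x‖ₑ ^ twoStar n s ≤ ENNReal.ofReal
      (((unitBallVol n)⁻¹ ^ (1 / 2 : ℝ) + (unitBallVol n)⁻¹ ^ (1 / twoStar n s)) ^ twoStar n s *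
        (eLpNorm u (ENNReal.ofReal (twoStar n s)) volume).toReal ^ (twoStar n s - 2)) *
      gagliardoAt s u x := by
  have hp := twoStar_pos hs0 hns
  have hp2 := two_lt_twoStar hs0 hns
  have hω := unitBallVol_pos n
  set p := twoStar n s
  set N := (eLpNorm u (ENNReal.ofReal p) volume).toReal with hNdef
  have hNpos : 0 < N := ENNReal.toReal_pos hN0 hN
  have hNe : eLpNorm u (ENNReal.ofReal p) volume = ENNReal.ofReal N := (ENNReal.ofReal_toReal hN).symm
  set C := (((unitBallVol n)⁻¹ ^ (1 / 2 : ℝ) + (unitBallVol n)⁻¹ ^ (1 / p)) ^ p * N ^ (p - 2))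
    with hC
  have hCpos : 0 < C := by positivity
  rw [mul_comm, ← ENNReal.div_le_iff (by simpa using hCpos) ENNReal.ofReal_ne_top]
  -- Replacing `gagliardoAt s u x` by any larger Y supplies the positivity that the optimal radius
  -- needs, also when the integral is zero.
  refine le_of_forall_gt_imp_ge_of_dense fun Y hY => ?_
  rcases eq_or_ne Y ∞ with rfl | hYt
  · exact le_top
  have hY0 : 0 < Y.toReal := ENNReal.toReal_pos (ne_bot_of_gt hY) hYt
  rw [ENNReal.div_le_iff (by simpa using hCpos) ENNReal.ofReal_ne_top]
  have key := rpow_le_of_forall_radius hs0 hns hω (norm_nonneg (u x)) hY0 hNpos fun r hr => by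
    have h1 := enorm_le_add_of_ball hs0 hu x hr (p := p) (by linarith)
    have h2 : ‖u x‖ₑ ≤ ENNReal.ofReal (((unitBallVol n)⁻¹ * r ^ (2 * s) * Y.toReal) ^ (1 / 2 : ℝ) +
      (r ^ n * (unitBallVol n))⁻¹ ^ (1 / p) * N) := by
      refine h1.trans ?_
      rw [ENNReal.ofReal_add (by positivity) (by positivity),
        ENNReal.ofReal_mul (q := N) (by positivity),
        ← ENNReal.ofReal_rpow_of_nonneg (p := 1 / 2) (by positivity) (by positivity),
        ENNReal.ofReal_mul (p := (unitBallVol n)⁻¹ * r ^ (2 * s)) (by positivity),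
        ENNReal.ofReal_toReal hYt, hNe]
      gcongr
    rwa [← ofReal_norm, ENNReal.ofReal_le_ofReal_iff (by positivity)] at h2
  rw [← ofReal_norm, ENNReal.ofReal_rpow_of_nonneg (norm_nonneg _) hp.le,
    ← ENNReal.ofReal_toReal hYt, ← ENNReal.ofReal_mul (by positivity)]
  exact ENNReal.ofReal_le_ofReal (key.trans_eq (mul_comm _ _))

/-- The square of the Gagliardo seminorm. -/
noncomputable def gagliardo (s : ℝ) (u : EuclideanSpace ℝ (Fin n) → ℝ) : ℝ≥0∞ :=
  ∫⁻ x, gagliardoAt s u x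

/-- The constant in the fractional Sobolev inequality. -/
noncomputable def sobolevConst (n : ℕ) (s : ℝ) : ℝ :=
  ((unitBallVol n)⁻¹ ^ (1 / 2 : ℝ) + (unitBallVol n)⁻¹ ^ (1 / twoStar n s)) ^ twoStar n s

lemma sobolevConst_pos (n : ℕ) (s : ℝ) : 0 < sobolevConst n s := by
  have := unitBallVol_pos n
  unfold sobolevConst; positivity

/-- Integrating the pointwise bound gives N^p ≤ C N^{p-2} [u]². Cancelling N^{p-2} is where
finiteness of N is indispensable. -/
lemma eLpNorm_sq_le_gagliardo_of_ne_top (hs0 : 0 < s) (hns : 2 * s < n)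
    {u : EuclideanSpace ℝ (Fin n) → ℝ} (hu : AEMeasurable u volume)
    (hN : eLpNorm u (ENNReal.ofReal (twoStar n s)) volume ≠ ∞) :
    eLpNorm u (ENNReal.ofReal (twoStar n s)) volume ^ 2 ≤
      ENNReal.ofReal (sobolevConst n s) * gagliardo s u := by
  have hp := twoStar_pos hs0 hns
  have hp2 := two_lt_twoStar hs0 hns
  rcases eq_or_ne (eLpNorm u (ENNReal.ofReal (twoStar n s)) volume) 0 with h0 | h0
  · simp [h0]
  have h1 := lintegral_mono (μ := volume) (enorm_rpow_le_gagliardoAt hs0 hns hu hN h0)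
  rw [lintegral_const_mul' _ _ ENNReal.ofReal_ne_top] at h1
  have h2 : ∫⁻ x, ‖u x‖ₑ ^ twoStar n s =
      eLpNorm u (ENNReal.ofReal (twoStar n s)) volume ^ twoStar n s := by
    rw [eLpNorm_eq_lintegral_rpow_enorm_toReal (by simpa using hp) ENNReal.ofReal_ne_top,
      ENNReal.toReal_ofReal hp.le, ← ENNReal.rpow_mul, one_div, inv_mul_cancel₀ hp.ne',
      ENNReal.rpow_one]
  rw [h2] at h1
  set p := twoStar n s
  set N := eLpNorm u (ENNReal.ofReal p) volume with hNdef
  have h3 : N ^ p = ENNReal.ofReal (N.toReal ^ (p - 2)) * N ^ 2 := by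
    rw [← ENNReal.ofReal_rpow_of_nonneg ENNReal.toReal_nonneg (by linarith),
      ENNReal.ofReal_toReal hN, ← ENNReal.rpow_two, ← ENNReal.rpow_add _ _ h0 hN]
    congr 1; ring
  have hNp : 0 < N.toReal := ENNReal.toReal_pos h0 hN
  rw [h3, mul_comm (_ ^ p), ENNReal.ofReal_mul (by positivity), mul_assoc] at h1
  exact (ENNReal.mul_le_mul_iff_right (by simp; positivity) ENNReal.ofReal_ne_top).1 h1

/-- Truncation at height `M`. -/
noncomputable def trunc (M t : ℝ) : ℝ := max (-M) (min t M)

/-- Being 1-Lipschitz, truncation does not increase the Gagliardo seminorm, while it makes the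
critical norm finite on sets of finite measure. -/
lemma abs_trunc_sub_le (M a b : ℝ) : |trunc M a - trunc M b| ≤ |a - b| := by
  unfold trunc
  rw [max_comm, max_comm (-M)]
  exact (abs_max_sub_max_le_abs _ _ _).trans ((abs_min_sub_min_le_max a M b M).trans (by simp))

lemma abs_trunc_le {M : ℝ} (hM : 0 ≤ M) (t : ℝ) : |trunc M t| ≤ M := by
  unfold trunc
  rw [abs_le]
  exact ⟨le_max_left _ _, max_le (by linarith) (min_le_right _ _)⟩

lemma trunc_eq {M t : ℝ} (h : |t| ≤ M) : trunc M t = t := by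
  rw [abs_le] at h
  rw [trunc, min_eq_left h.2, max_eq_right h.1]

lemma trunc_zero {M : ℝ} (hM : 0 ≤ M) : trunc M 0 = 0 := trunc_eq (by simpa)

lemma measurable_trunc (M : ℝ) : Measurable (trunc M) := by
  unfold trunc; fun_prop

/-- The fractional Sobolev inequality, for functions supported in a set of finite measure. -/
lemma eLpNorm_sq_le_gagliardo (hs0 : 0 < s) (hns : 2 * s < n)
    {Ω : Set (EuclideanSpace ℝ (Fin n))} (hΩ : volume Ω ≠ ∞) (hΩm : MeasurableSet Ω)
    {u : EuclideanSpace ℝ (Fin n) → ℝ} (hu : AEMeasurable u volume)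
    (hu0 : ∀ᵐ x ∂volume, x ∈ Ωᶜ → u x = 0) :
    eLpNorm u (ENNReal.ofReal (twoStar n s)) volume ^ 2 ≤
      ENNReal.ofReal (sobolevConst n s) * gagliardo s u := by
  set S := ENNReal.ofReal (sobolevConst n s) * gagliardo s u with hS
  have hm : ∀ k : ℕ, AEMeasurable (fun x => trunc k (u x)) volume := fun k =>
    (measurable_trunc k).comp_aemeasurable hu
  have hk : ∀ k : ℕ, eLpNorm (fun x => trunc k (u x)) (ENNReal.ofReal (twoStar n s)) volume ≤
      S ^ (1 / 2 : ℝ) := by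
    intro k
    have hfin : eLpNorm (fun x => trunc k (u x)) (ENNReal.ofReal (twoStar n s)) volume ≠ ∞ := by
      have h1 : eLpNorm (fun x => trunc k (u x)) (ENNReal.ofReal (twoStar n s)) volume ≤
          eLpNorm (Ω.indicator fun _ => (k : ℝ)) (ENNReal.ofReal (twoStar n s)) volume := by
        refine eLpNorm_mono_ae ?_
        filter_upwards [hu0] with x hx
        by_cases hxΩ : x ∈ Ω
        · simpa [hxΩ] using abs_trunc_le (Nat.cast_nonneg k) (u x)
        · simp [hx hxΩ, trunc_zero]
      exact (h1.trans_lt (memLp_indicator_const _ hΩm _ (Or.inr hΩ)).2).ne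
    have h2 := eLpNorm_sq_le_gagliardo_of_ne_top hs0 hns (hm k) hfin
    have h3 : gagliardo s (fun x => trunc k (u x)) ≤ gagliardo s u := by
      refine lintegral_mono fun x => lintegral_mono fun y => ?_
      gcongr
      rw [enorm_le_iff_norm_le]
      exact abs_trunc_sub_le _ _ _
    rw [one_div, ENNReal.le_rpow_inv_iff (by norm_num), ENNReal.rpow_two]
    exact h2.trans (by rw [hS]; gcongr)
  -- Fatou as the truncation height tends to infinity.
  have h4 : eLpNorm u (ENNReal.ofReal (twoStar n s)) volume ≤ S ^ (1 / 2 : ℝ) := by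
    refine Lp.eLpNorm_le_of_ae_tendsto (u := atTop) (f := fun (k : ℕ) x => trunc k (u x))
      (Eventually.of_forall hk) (fun k => (hm k).aestronglyMeasurable) (ae_of_all _ fun x => ?_)
    refine tendsto_const_nhds.congr' ?_
    filter_upwards [eventually_ge_atTop ⌈|u x|⌉₊] with k hk
    exact (trunc_eq ((Nat.le_ceil _).trans (by exact_mod_cast hk))).symm
  rwa [one_div, ENNReal.le_rpow_inv_iff (by norm_num), ENNReal.rpow_two] at h4

end Sobolev

/-- The standing hypotheses on the exponent, the domain and the kernel. -/
structure Admissible {n : ℕ} (s : ℝ) (K : EuclideanSpace ℝ (Fin n) → ℝ)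
    (Ω : Set (EuclideanSpace ℝ (Fin n))) : Prop where
  s_pos : 0 < s
  two_s_lt : 2 * s < n
  isOpen : IsOpen Ω
  isBounded : Bornology.IsBounded Ω
  nonempty : Ω.Nonempty
  kernel_pos : ∀ x, x ≠ 0 → 0 < K x
  integrable : Integrable (fun x => min (‖x‖ ^ 2) 1 * K x) volume
  lower_bound : ∃ k₀ : ℝ, 0 < k₀ ∧ ∀ x, x ≠ 0 → k₀ / ‖x‖ ^ ((n : ℝ) + 2 * s) ≤ K x

/-- The weighted difference `(u x - u y) √K(x - y)`. -/
noncomputable def wdiff {n : ℕ} (K : EuclideanSpace ℝ (Fin n) → ℝ)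
    (u : EuclideanSpace ℝ (Fin n) → ℝ)
    (p : EuclideanSpace ℝ (Fin n) × EuclideanSpace ℝ (Fin n)) : ℝ :=
  (u p.1 - u p.2) * √(K (p.1 - p.2))

/-! ### Linear structure of `X₀`. -/

section Algebra

variable {n : ℕ} {K : EuclideanSpace ℝ (Fin n) → ℝ} {Ω : Set (EuclideanSpace ℝ (Fin n))}

lemma wdiff_add (u v : EuclideanSpace ℝ (Fin n) → ℝ) :
    wdiff K (u + v) = wdiff K u + wdiff K v := by
  ext p; simp [wdiff]; ring

lemma wdiff_smul (c : ℝ) (u : EuclideanSpace ℝ (Fin n) → ℝ) :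
    wdiff K (c • u) = c • wdiff K u := by
  ext p; simp [wdiff]; ring

variable (K Ω) in
/-- `X₀` as a linear space. -/
def X₀Submodule : Submodule ℝ (EuclideanSpace ℝ (Fin n) → ℝ) where
  carrier := X₀ K Ω
  add_mem' := by
    rintro u v ⟨⟨hu1, hu2, hu3⟩, hu4⟩ ⟨⟨hv1, hv2, hv3⟩, hv4⟩
    refine ⟨⟨hu1.add hv1, hu2.add hv2, ?_⟩, ?_⟩
    · change MemLp (wdiff K (u + v)) 2 _
      rw [wdiff_add]
      exact MemLp.add hu3 hv3
    · filter_upwards [hu4, hv4] with x hx hx' hxΩ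
      simp [hx hxΩ, hx' hxΩ]
  zero_mem' := by
    refine ⟨⟨aemeasurable_const, MemLp.zero, ?_⟩, by simp⟩
    simp
  smul_mem' := by
    rintro c u ⟨⟨hu1, hu2, hu3⟩, hu4⟩
    refine ⟨⟨hu1.const_smul c, hu2.const_smul c, ?_⟩, ?_⟩
    · change MemLp (wdiff K (c • u)) 2 _
      rw [wdiff_smul]
      exact MemLp.const_smul hu3 c
    · filter_upwards [hu4] with x hx hxΩ
      simp [hx hxΩ]

lemma X₀.aemeasurable {u : EuclideanSpace ℝ (Fin n) → ℝ} (hu : u ∈ X₀ K Ω) :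
    AEMeasurable u volume := hu.1.1

lemma X₀.memLp_wdiff {u : EuclideanSpace ℝ (Fin n) → ℝ} (hu : u ∈ X₀ K Ω) :
    MemLp (wdiff K u) 2 (volume.restrict (Q Ω)) := hu.1.2.2

lemma X₀.add {u v : EuclideanSpace ℝ (Fin n) → ℝ} (hu : u ∈ X₀ K Ω) (hv : v ∈ X₀ K Ω) :
    u + v ∈ X₀ K Ω := (X₀Submodule K Ω).add_mem hu hv

lemma X₀.sub {u v : EuclideanSpace ℝ (Fin n) → ℝ} (hu : u ∈ X₀ K Ω) (hv : v ∈ X₀ K Ω) :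
    u - v ∈ X₀ K Ω := (X₀Submodule K Ω).sub_mem hu hv

lemma X₀.smul {u : EuclideanSpace ℝ (Fin n) → ℝ} (hu : u ∈ X₀ K Ω) (c : ℝ) :
    c • u ∈ X₀ K Ω := (X₀Submodule K Ω).smul_mem c hu

lemma X₀.zero : (0 : EuclideanSpace ℝ (Fin n) → ℝ) ∈ X₀ K Ω := (X₀Submodule K Ω).zero_mem

end Algebra

/-! ### The norm of `X₀` as an L² norm on `Q`. -/

section Norm

variable {n : ℕ} {s : ℝ} {K : EuclideanSpace ℝ (Fin n) → ℝ}
  {Ω : Set (EuclideanSpace ℝ (Fin n))} {u v : EuclideanSpace ℝ (Fin n) → ℝ}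

/-- Nothing is known about K at the origin, but on the diagonal the differences vanish; elsewhere K
is positive and splits as √K · √K. -/
lemma Admissible.mul_eq (h : Admissible s K Ω) (u v : EuclideanSpace ℝ (Fin n) → ℝ)
    (p : EuclideanSpace ℝ (Fin n) × EuclideanSpace ℝ (Fin n)) :
    (u p.1 - u p.2) * (v p.1 - v p.2) * K (p.1 - p.2) = wdiff K u p * wdiff K v p := by
  by_cases hp : p.1 = p.2
  · simp [wdiff, hp]
  · have := Real.mul_self_sqrt (h.kernel_pos _ (sub_ne_zero.2 hp)).le
    simp only [wdiff]
    linear_combination (-(u p.1 - u p.2) * (v p.1 - v p.2)) * this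

lemma Admissible.scalarProd_eq (h : Admissible s K Ω) (u v : EuclideanSpace ℝ (Fin n) → ℝ) :
    scalarProd K Ω u v = ∫ p in Q Ω, wdiff K u p * wdiff K v p := by
  simp only [scalarProd, h.mul_eq]

lemma normX₀_eq_sqrt (u : EuclideanSpace ℝ (Fin n) → ℝ) :
    normX₀ K Ω u = √(scalarProd K Ω u u) := by
  simp only [scalarProd, normX₀, sq_abs, ← sq]

lemma normX₀_nonneg (u : EuclideanSpace ℝ (Fin n) → ℝ) : 0 ≤ normX₀ K Ω u := Real.sqrt_nonneg _

lemma Admissible.normX₀_sq (h : Admissible s K Ω) (u : EuclideanSpace ℝ (Fin n) → ℝ) :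
    normX₀ K Ω u ^ 2 = scalarProd K Ω u u := by
  rw [normX₀_eq_sqrt, Real.sq_sqrt]
  rw [h.scalarProd_eq]
  exact integral_nonneg fun p => mul_self_nonneg _

lemma X₀.integrable_wdiff_mul (hu : u ∈ X₀ K Ω) (hv : v ∈ X₀ K Ω) :
    IntegrableOn (fun p => wdiff K u p * wdiff K v p) (Q Ω) :=
  (X₀.memLp_wdiff hu).integrable_mul (X₀.memLp_wdiff hv)

lemma Admissible.normX₀_eq (h : Admissible s K Ω) (hu : u ∈ X₀ K Ω) :
    normX₀ K Ω u = (eLpNorm (wdiff K u) 2 (volume.restrict (Q Ω))).toReal := by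
  rw [(X₀.memLp_wdiff hu).eLpNorm_eq_integral_rpow_norm (by norm_num) (by norm_num),
    ENNReal.toReal_ofReal (by positivity), normX₀_eq_sqrt, h.scalarProd_eq, Real.sqrt_eq_rpow]
  simp [← sq]

lemma Admissible.eLpNorm_wdiff (h : Admissible s K Ω) (hu : u ∈ X₀ K Ω) :
    eLpNorm (wdiff K u) 2 (volume.restrict (Q Ω)) = ENNReal.ofReal (normX₀ K Ω u) := by
  rw [h.normX₀_eq hu, ENNReal.ofReal_toReal (X₀.memLp_wdiff hu).2.ne]

lemma Admissible.normX₀_add_le (h : Admissible s K Ω) (hu : u ∈ X₀ K Ω) (hv : v ∈ X₀ K Ω) :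
    normX₀ K Ω (u + v) ≤ normX₀ K Ω u + normX₀ K Ω v := by
  rw [h.normX₀_eq hu, h.normX₀_eq hv, h.normX₀_eq (X₀.add hu hv),
    ← ENNReal.toReal_add (X₀.memLp_wdiff hu).2.ne (X₀.memLp_wdiff hv).2.ne, wdiff_add]
  exact ENNReal.toReal_mono
    (ENNReal.add_ne_top.2 ⟨(X₀.memLp_wdiff hu).2.ne, (X₀.memLp_wdiff hv).2.ne⟩)
    (eLpNorm_add_le (X₀.memLp_wdiff hu).1 (X₀.memLp_wdiff hv).1 (by norm_num))

lemma normX₀_smul (c : ℝ) (u : EuclideanSpace ℝ (Fin n) → ℝ) :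
    normX₀ K Ω (c • u) = |c| * normX₀ K Ω u := by
  have : ∀ p : EuclideanSpace ℝ (Fin n) × EuclideanSpace ℝ (Fin n),
      |(c • u) p.1 - (c • u) p.2| ^ 2 * K (p.1 - p.2) =
        c ^ 2 * (|u p.1 - u p.2| ^ 2 * K (p.1 - p.2)) := fun p => by
    simp only [Pi.smul_apply, smul_eq_mul, sq_abs]; ring
  simp only [normX₀, this]
  rw [integral_const_mul, Real.sqrt_mul (sq_nonneg c), Real.sqrt_sq_eq_abs]

lemma Admissible.normX₀_sub_le (h : Admissible s K Ω) (hu : u ∈ X₀ K Ω) (hv : v ∈ X₀ K Ω) :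
    normX₀ K Ω (u - v) ≤ normX₀ K Ω u + normX₀ K Ω v := by
  have h1 := h.normX₀_add_le hu (X₀.smul hv (-1))
  rwa [normX₀_smul, neg_one_smul, ← sub_eq_add_neg, abs_neg, abs_one, one_mul] at h1

lemma Admissible.normX₀_add_smul_sq (h : Admissible s K Ω) (hu : u ∈ X₀ K Ω) (hv : v ∈ X₀ K Ω)
    (t : ℝ) : normX₀ K Ω (u + t • v) ^ 2 =
      normX₀ K Ω u ^ 2 + 2 * t * scalarProd K Ω u v + t ^ 2 * normX₀ K Ω v ^ 2 := by
  simp only [h.normX₀_sq, h.scalarProd_eq, wdiff_add, wdiff_smul]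
  rw [← integral_const_mul, ← integral_const_mul, ← integral_add, ← integral_add]
  · congr 1; ext p; simp only [Pi.add_apply, Pi.smul_apply, smul_eq_mul]; ring
  · exact (X₀.integrable_wdiff_mul hu hu).add ((X₀.integrable_wdiff_mul hu hv).const_mul _)
  · exact (X₀.integrable_wdiff_mul hv hv).const_mul _
  · exact X₀.integrable_wdiff_mul hu hu
  · exact (X₀.integrable_wdiff_mul hu hv).const_mul _

/-- The parallelogram law, source of the strong convexity used for minimizing sequences. -/
lemma Admissible.normX₀_midpoint_sq (h : Admissible s K Ω) (hu : u ∈ X₀ K Ω) (hv : v ∈ X₀ K Ω) :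
    normX₀ K Ω ((1 / 2 : ℝ) • (u + v)) ^ 2 =
      normX₀ K Ω u ^ 2 / 2 + normX₀ K Ω v ^ 2 / 2 - normX₀ K Ω (u - v) ^ 2 / 4 := by
  have h1 := h.normX₀_add_smul_sq hu hv 1
  have h2 := h.normX₀_add_smul_sq hu hv (-1)
  rw [one_smul] at h1
  rw [neg_one_smul, ← sub_eq_add_neg] at h2
  rw [normX₀_smul, mul_pow, h1, h2, sq_abs]
  ring

end Norm

/-! ### Continuous embedding of `X₀` and closedness under a.e. limits. -/

section Embedding

variable {n : ℕ} {s : ℝ} {K : EuclideanSpace ℝ (Fin n) → ℝ}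
  {Ω : Set (EuclideanSpace ℝ (Fin n))} {u v : EuclideanSpace ℝ (Fin n) → ℝ}

lemma Admissible.n_pos (h : Admissible s K Ω) : 0 < n := by
  have := h.s_pos; have := h.two_s_lt
  exact_mod_cast (by linarith : (0 : ℝ) < n)

lemma Admissible.measurableSet (h : Admissible s K Ω) : MeasurableSet Ω := h.isOpen.measurableSet

lemma Admissible.measurableSet_Q (h : Admissible s K Ω) : MeasurableSet (Q Ω) :=
  (h.measurableSet.compl.prod h.measurableSet.compl).compl

lemma Admissible.volume_lt_top (h : Admissible s K Ω) : volume Ω < ∞ := h.isBounded.measure_lt_top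

/-- Measurability of K is recovered from integrability of the weighted kernel by dividing by the
weight, which vanishes only at the origin, a null set because n > 0. -/
lemma Admissible.aemeasurable_kernel (h : Admissible s K Ω) : AEMeasurable K volume := by
  have : Nonempty (Fin n) := ⟨⟨0, h.n_pos⟩⟩
  have h1 : AEMeasurable (fun x : EuclideanSpace ℝ (Fin n) =>
      (min (‖x‖ ^ 2) 1)⁻¹ * (min (‖x‖ ^ 2) 1 * K x)) volume :=
    AEMeasurable.mul (by fun_prop) h.integrable.aestronglyMeasurable.aemeasurable
  refine h1.congr ?_
  filter_upwards [compl_mem_ae_iff.2 (measure_singleton (0 : EuclideanSpace ℝ (Fin n)))] with x hx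
  have hx0 : x ≠ 0 := hx
  have : 0 < min (‖x‖ ^ 2) 1 := lt_min (by positivity) one_pos
  field_simp

lemma quasiMeasurePreserving_sub_prod :
    Measure.QuasiMeasurePreserving
      (fun p : EuclideanSpace ℝ (Fin n) × EuclideanSpace ℝ (Fin n) => p.1 - p.2) volume volume :=
  Measure.quasiMeasurePreserving_fst.comp
    (measurePreserving_sub_prod (volume : Measure (EuclideanSpace ℝ (Fin n)))
      (volume : Measure (EuclideanSpace ℝ (Fin n)))).quasiMeasurePreserving

lemma aemeasurable_fst (hu : AEMeasurable u volume) :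
    AEMeasurable (fun p : EuclideanSpace ℝ (Fin n) × EuclideanSpace ℝ (Fin n) => u p.1) volume :=
  hu.comp_quasiMeasurePreserving Measure.quasiMeasurePreserving_fst

lemma aemeasurable_snd (hu : AEMeasurable u volume) :
    AEMeasurable (fun p : EuclideanSpace ℝ (Fin n) × EuclideanSpace ℝ (Fin n) => u p.2) volume :=
  hu.comp_quasiMeasurePreserving Measure.quasiMeasurePreserving_snd

lemma Admissible.aemeasurable_wdiff (h : Admissible s K Ω) (hu : AEMeasurable u volume) :
    AEMeasurable (wdiff K u) volume :=
  ((aemeasurable_fst hu).sub (aemeasurable_snd hu)).mul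
    (h.aemeasurable_kernel.comp_quasiMeasurePreserving quasiMeasurePreserving_sub_prod).sqrt

/-- Off `Q` both points lie outside Ω, where u vanishes; so restricting to `Q` loses nothing against
the full Gagliardo integral. -/
lemma Admissible.lintegral_wdiff (h : Admissible s K Ω)
    (hu0 : ∀ᵐ x ∂volume, x ∈ Ωᶜ → u x = 0) :
    ∫⁻ p, ‖wdiff K u p‖ₑ ^ 2 = ∫⁻ p in Q Ω, ‖wdiff K u p‖ₑ ^ 2 := by
  rw [← lintegral_add_compl _ h.measurableSet_Q]
  suffices ∫⁻ p in (Q Ω)ᶜ, ‖wdiff K u p‖ₑ ^ 2 = 0 by rw [this, add_zero]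
  rw [setLIntegral_congr_fun_ae (g := 0) h.measurableSet_Q.compl]
  · simp
  have h1 := (Measure.quasiMeasurePreserving_fst (μ := (volume : Measure (EuclideanSpace ℝ (Fin n))))
    (ν := (volume : Measure (EuclideanSpace ℝ (Fin n))))).ae hu0
  have h2 := (Measure.quasiMeasurePreserving_snd (μ := (volume : Measure (EuclideanSpace ℝ (Fin n))))
    (ν := (volume : Measure (EuclideanSpace ℝ (Fin n))))).ae hu0
  filter_upwards [h1, h2] with p hp1 hp2 hp
  rw [Q, compl_compl] at hp
  simp [wdiff, hp1 hp.1, hp2 hp.2]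

lemma Admissible.exists_gagliardo_le (h : Admissible s K Ω) :
    ∃ A : ℝ, 0 < A ∧ ∀ u : EuclideanSpace ℝ (Fin n) → ℝ, AEMeasurable u volume →
      (∀ᵐ x ∂volume, x ∈ Ωᶜ → u x = 0) →
      gagliardo s u ≤ ENNReal.ofReal A * eLpNorm (wdiff K u) 2 (volume.restrict (Q Ω)) ^ 2 := by
  obtain ⟨k₀, hk₀, hk⟩ := h.lower_bound
  refine ⟨k₀⁻¹, inv_pos.2 hk₀, fun u hu hu0 => ?_⟩
  have h1 : gagliardo s u = ∫⁻ p : EuclideanSpace ℝ (Fin n) × EuclideanSpace ℝ (Fin n),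
      ‖u p.1 - u p.2‖ₑ ^ 2 * (ENNReal.ofReal (‖p.1 - p.2‖ ^ ((n : ℝ) + 2 * s)))⁻¹ := by
    rw [Measure.volume_eq_prod, lintegral_prod]
    · rfl
    · exact (((aemeasurable_fst hu).sub (aemeasurable_snd hu)).enorm.pow_const 2).mul (by fun_prop)
  have h2 : eLpNorm (wdiff K u) 2 (volume.restrict (Q Ω)) ^ 2 =
      ∫⁻ p, ‖wdiff K u p‖ₑ ^ 2 := by
    rw [h.lintegral_wdiff hu0, eLpNorm_eq_lintegral_rpow_enorm_toReal (by norm_num) (by norm_num),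
      ← ENNReal.rpow_natCast, ← ENNReal.rpow_mul]
    simp
  rw [h1, h2, ← lintegral_const_mul' _ _ ENNReal.ofReal_ne_top]
  refine lintegral_mono fun p => ?_
  by_cases hp : p.1 = p.2
  · simp [hp]
  have hp' : p.1 - p.2 ≠ 0 := sub_ne_zero.2 hp
  have hpos : 0 < ‖p.1 - p.2‖ ^ ((n : ℝ) + 2 * s) := Real.rpow_pos_of_pos (norm_pos_iff.2 hp') _
  have hK := hk _ hp'
  rw [← ENNReal.ofReal_inv_of_pos hpos]
  rw [← ofReal_norm, ← ofReal_norm, Real.norm_eq_abs, Real.norm_eq_abs,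
    ← ENNReal.ofReal_pow (abs_nonneg _), ← ENNReal.ofReal_pow (abs_nonneg _), sq_abs, sq_abs]
  rw [← ENNReal.ofReal_mul (by positivity), ← ENNReal.ofReal_mul (by positivity)]
  apply ENNReal.ofReal_le_ofReal
  rw [wdiff, mul_pow, Real.sq_sqrt (h.kernel_pos _ hp').le]
  calc (u p.1 - u p.2) ^ 2 * (‖p.1 - p.2‖ ^ ((n : ℝ) + 2 * s))⁻¹
      = k₀⁻¹ * ((u p.1 - u p.2) ^ 2 * (k₀ / ‖p.1 - p.2‖ ^ ((n : ℝ) + 2 * s))) := by field_simp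
    _ ≤ _ := by gcongr

/-- The embedding of `X₀` in `L^{2^*}`, for functions of possibly infinite norm. -/
lemma Admissible.exists_sobolev (h : Admissible s K Ω) :
    ∃ A : ℝ, 0 < A ∧ ∀ u : EuclideanSpace ℝ (Fin n) → ℝ, AEMeasurable u volume →
      (∀ᵐ x ∂volume, x ∈ Ωᶜ → u x = 0) →
      eLpNorm u (ENNReal.ofReal (twoStar n s)) volume ≤
        ENNReal.ofReal A * eLpNorm (wdiff K u) 2 (volume.restrict (Q Ω)) := by
  obtain ⟨A, hA, H⟩ := h.exists_gagliardo_le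
  have hS := sobolevConst_pos n s
  refine ⟨√(sobolevConst n s * A), by positivity, fun u hu hu0 => ?_⟩
  have h1 := eLpNorm_sq_le_gagliardo h.s_pos h.two_s_lt h.volume_lt_top.ne h.measurableSet hu hu0
  have h2 := h1.trans (mul_le_mul_right (H u hu hu0) _)
  rw [← mul_assoc, ← ENNReal.ofReal_mul hS.le] at h2
  rw [← ENNReal.pow_le_pow_left_iff two_ne_zero, mul_pow, ← ENNReal.ofReal_pow (by positivity),
    Real.sq_sqrt (by positivity)]
  exact h2

/-- The L²(Ω) condition is automatic: the Sobolev bound holds before membership is known, and Ω has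
finite measure with 2 < 2^*. -/
lemma Admissible.mem_X₀ (h : Admissible s K Ω) (hu : AEMeasurable u volume)
    (hu0 : ∀ᵐ x ∂volume, x ∈ Ωᶜ → u x = 0)
    (hfin : eLpNorm (wdiff K u) 2 (volume.restrict (Q Ω)) < ∞) : u ∈ X₀ K Ω := by
  obtain ⟨A, -, H⟩ := h.exists_sobolev
  have : IsFiniteMeasure (volume.restrict Ω) := ⟨by simpa using h.volume_lt_top⟩
  have h1 : MemLp u (ENNReal.ofReal (twoStar n s)) volume :=
    ⟨hu.aestronglyMeasurable, (H u hu hu0).trans_lt (ENNReal.mul_lt_top ENNReal.ofReal_lt_top hfin)⟩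
  refine ⟨⟨hu, (h1.restrict Ω).mono_exponent ?_, ?_, hfin⟩, hu0⟩
  · have := two_lt_twoStar h.s_pos h.two_s_lt
    rw [← ENNReal.ofReal_ofNat]
    exact ENNReal.ofReal_le_ofReal this.le
  · exact (h.aemeasurable_wdiff hu).aestronglyMeasurable.restrict

/-- `X₀` embeds in `L^{2^*}`. -/
lemma Admissible.exists_sobolev_normX₀ (h : Admissible s K Ω) :
    ∃ A : ℝ, 0 < A ∧ ∀ u ∈ X₀ K Ω,
      eLpNorm u (ENNReal.ofReal (twoStar n s)) volume ≤ ENNReal.ofReal (A * normX₀ K Ω u) := by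
  obtain ⟨A, hA, H⟩ := h.exists_sobolev
  refine ⟨A, hA, fun u hu => ?_⟩
  rw [ENNReal.ofReal_mul hA.le, ← h.eLpNorm_wdiff hu]
  exact H u hu.1.1 hu.2

lemma Admissible.embConstENN_ne_top (h : Admissible s K Ω) :
    embConstENN K Ω (twoStar n s) ≠ ∞ := by
  obtain ⟨A, hA, H⟩ := h.exists_sobolev_normX₀
  refine ne_top_of_le_ne_top (b := ENNReal.ofReal A) ENNReal.ofReal_ne_top ?_
  refine iSup₂_le fun u hu => ENNReal.div_le_of_le_mul ?_
  rw [← ENNReal.ofReal_mul hA.le]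
  exact H u hu.1

/-- Fatou: a.e. limits of bounded sequences of `X₀` stay in `X₀`. -/
lemma Admissible.mem_X₀_of_tendsto (h : Admissible s K Ω)
    {w : ℕ → EuclideanSpace ℝ (Fin n) → ℝ} (hw : ∀ k, w k ∈ X₀ K Ω) {R : ℝ} (hR : 0 ≤ R)
    (hwR : ∀ᶠ k in atTop, normX₀ K Ω (w k) ≤ R)
    (hlim : ∀ᵐ x ∂volume, Tendsto (fun k => w k x) atTop (𝓝 (u x))) :
    u ∈ X₀ K Ω ∧ normX₀ K Ω u ≤ R := by
  have hu : AEMeasurable u volume :=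
    aemeasurable_of_tendsto_metrizable_ae atTop (fun k => (hw k).1.1) hlim
  have hu0 : ∀ᵐ x ∂volume, x ∈ Ωᶜ → u x = 0 := by
    filter_upwards [hlim, ae_all_iff.2 fun k => (hw k).2] with x hx hx0 hxΩ
    refine tendsto_nhds_unique hx ?_
    simp [hx0 _ hxΩ]
  have hle : eLpNorm (wdiff K u) 2 (volume.restrict (Q Ω)) ≤ ENNReal.ofReal R := by
    refine Lp.eLpNorm_le_of_ae_tendsto (u := atTop) (f := fun k => wdiff K (w k))
      ?_ (fun k => (X₀.memLp_wdiff (hw k)).1) (ae_restrict_of_ae ?_)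
    · filter_upwards [hwR] with k hk
      rw [h.eLpNorm_wdiff (hw k)]
      exact ENNReal.ofReal_le_ofReal hk
    · have h1 := (Measure.quasiMeasurePreserving_fst
        (μ := (volume : Measure (EuclideanSpace ℝ (Fin n))))
        (ν := (volume : Measure (EuclideanSpace ℝ (Fin n))))).ae hlim
      have h2 := (Measure.quasiMeasurePreserving_snd
        (μ := (volume : Measure (EuclideanSpace ℝ (Fin n))))
        (ν := (volume : Measure (EuclideanSpace ℝ (Fin n))))).ae hlim
      filter_upwards [h1, h2] with p hp1 hp2
      exact (hp1.sub hp2).mul_const _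
  have hmem := h.mem_X₀ hu hu0 (hle.trans_lt ENNReal.ofReal_lt_top)
  refine ⟨hmem, ?_⟩
  rw [h.eLpNorm_wdiff hmem] at hle
  exact (ENNReal.ofReal_le_ofReal_iff hR).1 hle

end Embedding

/-- Every bounded sequence of a separable Hilbert space has a subsequence along which all scalar
products converge. -/
lemma exists_subseq_tendsto_inner {H : Type*} [NormedAddCommGroup H] [InnerProductSpace ℝ H]
    [CompleteSpace H] [TopologicalSpace.SeparableSpace H] {f : ℕ → H} {R : ℝ}
    (hf : ∀ k, ‖f k‖ ≤ R) :
    ∃ φ : ℕ → ℕ, StrictMono φ ∧ ∀ g : H, ∃ l : ℝ,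
      Tendsto (fun k => inner ℝ (f (φ k)) g) atTop (𝓝 l) := by
  -- Sequential Banach–Alaoglu in the dual, transported by the Riesz isomorphism.
  have hc := WeakDual.isSeqCompact_closedBall ℝ H 0 R
  obtain ⟨a, -, φ, hφ, hlim⟩ := hc (x := fun k => StrongDual.toWeakDual
    (InnerProductSpace.toDual ℝ H (f k))) (fun k => by
      simpa using hf k)
  refine ⟨φ, hφ, fun g => ⟨a g, ?_⟩⟩
  have := (WeakDual.eval_continuous g).continuousAt.tendsto.comp hlim
  simpa [Function.comp_def] using this

/-! ### Approximation by ball averages. -/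

section Average

variable {n : ℕ} {s : ℝ}

/-- The mean value over a ball. -/
noncomputable def ballAvg (r : ℝ) (u : EuclideanSpace ℝ (Fin n) → ℝ)
    (x : EuclideanSpace ℝ (Fin n)) : ℝ :=
  ∫ y, u y ∂(ProbabilityTheory.cond volume (Metric.ball x r))

lemma ballAvg_eq {r : ℝ} (hr : 0 < r) (u : EuclideanSpace ℝ (Fin n) → ℝ)
    (x : EuclideanSpace ℝ (Fin n)) :
    ballAvg r u x = (r ^ n * unitBallVol n)⁻¹ * ∫ y in Metric.ball x r, u y := by
  have := unitBallVol_pos n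
  rw [ballAvg, ProbabilityTheory.cond, integral_smul_measure, volume_ball_eq x hr,
    ENNReal.toReal_inv, ENNReal.toReal_ofReal (by positivity), smul_eq_mul]

lemma ballAvg_sub {r : ℝ} (hr : 0 < r) {u v : EuclideanSpace ℝ (Fin n) → ℝ}
    (hu : Integrable u volume) (hv : Integrable v volume) :
    ballAvg r (u - v) = ballAvg r u - ballAvg r v := by
  ext x
  simp only [Pi.sub_apply, ballAvg_eq hr]
  rw [integral_sub hu.integrableOn hv.integrableOn, mul_sub]

lemma aestronglyMeasurable_ballAvg {r : ℝ} (hr : 0 < r) {u : EuclideanSpace ℝ (Fin n) → ℝ}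
    (hu : AEMeasurable u volume) : AEStronglyMeasurable (ballAvg r u) volume := by
  have h1 : ballAvg r u = fun x => (r ^ n * unitBallVol n)⁻¹ *
      ∫ y, {p : EuclideanSpace ℝ (Fin n) × EuclideanSpace ℝ (Fin n) | dist p.2 p.1 < r}.indicator
        (fun p => u p.2) (x, y) := by
    ext x
    rw [ballAvg_eq hr, ← integral_indicator measurableSet_ball]
    rfl
  rw [h1]
  refine AEStronglyMeasurable.const_mul ?_ _
  exact ((aemeasurable_snd hu).aestronglyMeasurable.indicator
    (measurableSet_lt (by fun_prop) measurable_const)).integral_prod_right'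

lemma enorm_sub_ballAvg_sq_le (hs0 : 0 < s) {u : EuclideanSpace ℝ (Fin n) → ℝ}
    (hu : Integrable u volume) (x : EuclideanSpace ℝ (Fin n)) {r : ℝ} (hr : 0 < r) :
    ‖u x - ballAvg r u x‖ₑ ^ 2 ≤
      ENNReal.ofReal ((unitBallVol n)⁻¹ * r ^ (2 * s)) * gagliardoAt s u x := by
  have : Fact (0 < r) := ⟨hr⟩
  have hi : Integrable u (ProbabilityTheory.cond volume (Metric.ball x r)) :=
    hu.integrableOn.smul_measure (by simp [(Metric.measure_ball_pos volume x hr).ne'])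
  have h1 : u x - ballAvg r u x =
      ∫ y, (u x - u y) ∂(ProbabilityTheory.cond volume (Metric.ball x r)) := by
    rw [integral_sub (integrable_const _) hi, ballAvg]
    simp
  have h2 : ‖u x - ballAvg r u x‖ₑ ≤
      (ENNReal.ofReal ((unitBallVol n)⁻¹ * r ^ (2 * s)) * gagliardoAt s u x) ^ (1 / 2 : ℝ) := by
    rw [h1]
    refine (enorm_integral_le_lintegral_enorm _).trans ?_
    rw [← eLpNorm_one_eq_lintegral_enorm]
    exact eLpNorm_one_cond_ball_sub_le hs0 hu.aestronglyMeasurable.aemeasurable x hr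
  rwa [one_div, ENNReal.le_rpow_inv_iff (by norm_num), ENNReal.rpow_two] at h2

/-- The error is of order r^s times the seminorm, hence small uniformly on bounded sets of `X₀`;
this is the source of compactness. -/
lemma eLpNorm_sub_ballAvg_le (hs0 : 0 < s) {u : EuclideanSpace ℝ (Fin n) → ℝ}
    (hu : Integrable u volume) {r : ℝ} (hr : 0 < r) (Ω : Set (EuclideanSpace ℝ (Fin n))) :
    eLpNorm (u - ballAvg r u) 2 (volume.restrict Ω) ≤
      (ENNReal.ofReal ((unitBallVol n)⁻¹ * r ^ (2 * s)) * gagliardo s u) ^ (1 / 2 : ℝ) := by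
  rw [eLpNorm_eq_lintegral_rpow_enorm_toReal (by norm_num) (by norm_num)]
  simp only [ENNReal.toReal_ofNat, Pi.sub_apply, ENNReal.rpow_two]
  gcongr
  refine (setLIntegral_le_lintegral _ _).trans ?_
  rw [gagliardo, ← lintegral_const_mul' _ _ ENNReal.ofReal_ne_top]
  exact lintegral_mono fun x => enorm_sub_ballAvg_sq_le hs0 hu x hr

end Average

/-! ### Compact embedding in L²(Ω) and L¹(Ω). -/

section Compactness

variable {n : ℕ} {s : ℝ} {K : EuclideanSpace ℝ (Fin n) → ℝ}
  {Ω : Set (EuclideanSpace ℝ (Fin n))} {u v : EuclideanSpace ℝ (Fin n) → ℝ}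

lemma Admissible.isFiniteMeasure (h : Admissible s K Ω) : IsFiniteMeasure (volume.restrict Ω) :=
  ⟨by simpa using h.volume_lt_top⟩

lemma Admissible.integrable_of_mem (h : Admissible s K Ω) (hu : u ∈ X₀ K Ω) : Integrable u volume := by
  have := h.isFiniteMeasure
  have h1 : IntegrableOn u Ω := hu.1.2.1.integrable (by norm_num)
  refine ((integrable_indicator_iff h.measurableSet).2 h1).congr ?_
  filter_upwards [hu.2] with x hx
  by_cases hxΩ : x ∈ Ω
  · simp [hxΩ]
  · simp [hxΩ, hx hxΩ]

lemma Admissible.exists_eLpNorm_two_le (h : Admissible s K Ω) :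
    ∃ B : ℝ, 0 ≤ B ∧ ∀ u ∈ X₀ K Ω,
      eLpNorm u 2 (volume.restrict Ω) ≤ ENNReal.ofReal (B * normX₀ K Ω u) := by
  obtain ⟨A, hA, H⟩ := h.exists_sobolev_normX₀
  have hp2 := two_lt_twoStar h.s_pos h.two_s_lt
  set e : ℝ := 1 / (2 : ℝ≥0∞).toReal - 1 / (ENNReal.ofReal (twoStar n s)).toReal with he
  have hfin : volume Ω ^ e ≠ ∞ := by
    refine ENNReal.rpow_ne_top_of_nonneg ?_ h.volume_lt_top.ne
    rw [he, ENNReal.toReal_ofReal (by linarith), sub_nonneg]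
    simp only [ENNReal.toReal_ofNat]
    gcongr
  refine ⟨A * (volume Ω ^ e).toReal, by positivity, fun u hu => ?_⟩
  refine (eLpNorm_le_eLpNorm_mul_rpow_measure_univ (q := ENNReal.ofReal (twoStar n s)) ?_
    hu.1.2.1.1).trans ?_
  · rw [← ENNReal.ofReal_ofNat]
    exact ENNReal.ofReal_le_ofReal hp2.le
  · rw [Measure.restrict_apply_univ, mul_right_comm, ENNReal.ofReal_mul (by
      have := normX₀_nonneg (K := K) (Ω := Ω) u; positivity), ENNReal.ofReal_toReal hfin]
    gcongr
    exact (eLpNorm_restrict_le _ _ _ _).trans (H u hu)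

/-- Written as a scalar product in L²(Ω), the integral over a ball passes to the limit under weak
convergence. -/
lemma X₀.setIntegral_ball_eq (hu : u ∈ X₀ K Ω)
    (x : EuclideanSpace ℝ (Fin n)) (r : ℝ) :
    ∫ y in Metric.ball x r, u y = inner ℝ hu.1.2.1.toLp (indicatorConstLp 2
      (μ := volume.restrict Ω) (measurableSet_ball (x := x) (ε := r))
      ((Measure.restrict_apply_le _ _).trans_lt measure_ball_lt_top).ne (1 : ℝ)) := by
  rw [real_inner_comm, L2.inner_indicatorConstLp_one,
    integral_congr_ae (ae_restrict_of_ae hu.1.2.1.coeFn_toLp),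
    Measure.restrict_restrict measurableSet_ball]
  refine setIntegral_eq_of_subset_of_ae_sdiff_eq_zero
    (measurableSet_ball (x := x) (ε := r)).nullMeasurableSet inter_subset_left ?_
  filter_upwards [hu.2] with y hy hy'
  exact hy fun hyΩ => hy'.2 ⟨hy'.1, hyΩ⟩

/-- A bounded sequence of `X₀` has a subsequence converging in `L²(Ω)`. -/
lemma Admissible.exists_subseq_cauchy (h : Admissible s K Ω)
    {w : ℕ → EuclideanSpace ℝ (Fin n) → ℝ} (hw : ∀ k, w k ∈ X₀ K Ω) {R : ℝ}
    (hwR : ∀ k, normX₀ K Ω (w k) ≤ R) :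
    ∃ φ : ℕ → ℕ, StrictMono φ ∧ ∀ ε : ℝ≥0∞, 0 < ε → ∃ N, ∀ j ≥ N, ∀ k ≥ N,
      eLpNorm (w (φ j) - w (φ k)) 2 (volume.restrict Ω) < ε := by
  have hfin := h.isFiniteMeasure
  have hω := unitBallVol_pos n
  have hR : 0 ≤ R := (normX₀_nonneg _).trans (hwR 0)
  obtain ⟨B, hB, HB⟩ := h.exists_eLpNorm_two_le
  obtain ⟨A, hA, HA⟩ := h.exists_gagliardo_le
  have hnorm : ∀ k, ‖(hw k).1.2.1.toLp‖ ≤ B * R := fun k => by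
    rw [Lp.norm_toLp]
    refine ENNReal.toReal_le_of_le_ofReal (by positivity) ((HB _ (hw k)).trans ?_)
    exact ENNReal.ofReal_le_ofReal (mul_le_mul_of_nonneg_left (hwR k) hB)
  have : Fact ((1 : ℝ≥0∞) ≤ 2) := ⟨by norm_num⟩
  have : Fact ((2 : ℝ≥0∞) ≠ ∞) := ⟨by norm_num⟩
  obtain ⟨φ, hφ, hlim⟩ := exists_subseq_tendsto_inner hnorm
  refine ⟨φ, hφ, fun ε hε => ?_⟩
  have hw' : ∀ k, Integrable (w (φ k)) volume := fun k => h.integrable_of_mem (hw _)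
  obtain ⟨ε', hε'0, hε'⟩ : ∃ ε' : ℝ≥0∞, 0 < ε' ∧ ε' + (ε' + ε') < ε := by
    refine ⟨min (ε / 4) 1, lt_min (ENNReal.div_pos hε.ne' (by norm_num)) one_pos, ?_⟩
    rcases eq_or_ne ε ∞ with rfl | hεt
    · refine ENNReal.add_lt_top.2 ⟨?_, ENNReal.add_lt_top.2 ⟨?_, ?_⟩⟩ <;>
        exact (min_le_right _ _).trans_lt ENNReal.one_lt_top
    · have h0 : 0 < ε.toReal := ENNReal.toReal_pos hε.ne' hεt
      have h1 : min (ε / 4) 1 ≤ ENNReal.ofReal (ε.toReal / 4) := by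
        rw [ENNReal.ofReal_div_of_pos (by norm_num), ENNReal.ofReal_toReal hεt]
        simp
      refine (add_le_add h1 (add_le_add h1 h1)).trans_lt ?_
      rw [← ENNReal.ofReal_add (by positivity) (by positivity),
        ← ENNReal.ofReal_add (by positivity) (by positivity),
        ENNReal.ofReal_lt_iff_lt_toReal (by positivity) hεt]
      linarith
  -- The radius is fixed here, independently of the indices; 2R bounds the norm of a difference of
  -- two terms.
  obtain ⟨r, hr, hrε⟩ : ∃ r : ℝ, 0 < r ∧ (ENNReal.ofReal ((unitBallVol n)⁻¹ * r ^ (2 * s)) *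
      (ENNReal.ofReal A * ENNReal.ofReal (2 * R) ^ 2)) ^ (1 / 2 : ℝ) < ε' := by
    have h1 : Tendsto (fun r : ℝ => (ENNReal.ofReal ((unitBallVol n)⁻¹ * r ^ (2 * s)) *
        (ENNReal.ofReal A * ENNReal.ofReal (2 * R) ^ 2)) ^ (1 / 2 : ℝ)) (𝓝 0) (𝓝 0) := by
      have h2 : Tendsto (fun r : ℝ => (unitBallVol n)⁻¹ * r ^ (2 * s)) (𝓝 0) (𝓝 0) := by
        have := (Real.continuousAt_rpow_const 0 (2 * s)
          (Or.inr (by linarith [h.s_pos]))).tendsto.const_mul (unitBallVol n)⁻¹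
        rwa [Real.zero_rpow (by linarith [h.s_pos]), mul_zero] at this
      have h3 := ENNReal.tendsto_ofReal h2
      rw [ENNReal.ofReal_zero] at h3
      have h4 := ENNReal.Tendsto.mul_const (b := ENNReal.ofReal A * ENNReal.ofReal (2 * R) ^ 2) h3
        (Or.inr (by finiteness))
      rw [zero_mul] at h4
      have h5 := h4.ennrpow_const (1 / 2)
      rwa [ENNReal.zero_rpow_of_pos (by norm_num)] at h5
    have h6 := (h1.mono_left (nhdsWithin_le_nhds (s := Ioi 0))).eventually_lt_const hε'0
    obtain ⟨r, hr1, hr2⟩ := (h6.and self_mem_nhdsWithin).exists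
    exact ⟨r, hr2, hr1⟩
  have hdiff : ∀ j k, eLpNorm ((w (φ j) - w (φ k)) - ballAvg r (w (φ j) - w (φ k))) 2
      (volume.restrict Ω) ≤ ε' := fun j k => by
    have hm := X₀.sub (hw (φ j)) (hw (φ k))
    refine (eLpNorm_sub_ballAvg_le h.s_pos (h.integrable_of_mem hm) hr Ω).trans (le_trans ?_ hrε.le)
    gcongr
    refine (HA _ hm.1.1 hm.2).trans ?_
    rw [h.eLpNorm_wdiff hm]
    gcongr
    linarith [h.normX₀_sub_le (hw (φ j)) (hw (φ k)), hwR (φ j), hwR (φ k)]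
  choose a ha using fun x : EuclideanSpace ℝ (Fin n) => hlim (indicatorConstLp 2
      (μ := volume.restrict Ω) (measurableSet_ball (x := x) (ε := r))
      ((Measure.restrict_apply_le _ _).trans_lt measure_ball_lt_top).ne (1 : ℝ))
  set c := (r ^ n * unitBallVol n)⁻¹ with hc
  have hc0 : 0 ≤ c := by positivity
  have hpt : ∀ x, Tendsto (fun k => ballAvg r (w (φ k)) x) atTop (𝓝 (c * a x)) := fun x => by
    simp only [ballAvg_eq hr, fun k => X₀.setIntegral_ball_eq (hw (φ k)) x r]
    exact (ha x).const_mul c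
  set M := c * (B * R * (volume.restrict Ω).real univ ^ (1 / 2 : ℝ)) with hM
  have hM0 : 0 ≤ M := by positivity
  -- At fixed r, Cauchy–Schwarz bounds the averages uniformly; with pointwise convergence and finite
  -- measure, dominated convergence applies.
  have hbd : ∀ k x, |ballAvg r (w (φ k)) x| ≤ M := fun k x => by
    rw [ballAvg_eq hr, X₀.setIntegral_ball_eq (hw (φ k)) x r, abs_mul, abs_of_nonneg hc0]
    refine mul_le_mul_of_nonneg_left ((abs_real_inner_le_norm _ _).trans ?_) hc0
    refine mul_le_mul (hnorm _) (norm_indicatorConstLp_le.trans ?_) (norm_nonneg _) (by positivity)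
    simp only [norm_one, one_mul, ENNReal.toReal_ofNat]
    exact Real.rpow_le_rpow measureReal_nonneg (measureReal_mono (subset_univ _)) (by norm_num)
  have hmeas : ∀ k, AEStronglyMeasurable (ballAvg r (w (φ k))) (volume.restrict Ω) := fun k =>
    (aestronglyMeasurable_ballAvg hr (hw _).1.1).restrict
  have hmeas' : AEStronglyMeasurable (fun x => c * a x) (volume.restrict Ω) :=
    aestronglyMeasurable_of_tendsto_ae atTop hmeas (ae_of_all _ hpt)
  have hL2 : Tendsto (fun k => eLpNorm (ballAvg r (w (φ k)) - fun x => c * a x) 2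
      (volume.restrict Ω)) atTop (𝓝 0) := by
    have h1 : Tendsto (fun k => ∫⁻ x in Ω, ‖ballAvg r (w (φ k)) x - c * a x‖ₑ ^ 2) atTop
        (𝓝 (∫⁻ _ in Ω, 0)) := by
      refine tendsto_lintegral_of_dominated_convergence' (fun _ => ENNReal.ofReal (2 * M) ^ 2)
        (fun k => ((hmeas k).sub hmeas').enorm.pow_const 2) (fun k => ae_of_all _ fun x => ?_)
        (by rw [lintegral_const]; exact ENNReal.mul_ne_top (by finiteness) (measure_ne_top _ _))
        (ae_of_all _ fun x => ?_)
      · have h2 : |c * a x| ≤ M := le_of_tendsto (hpt x).abs (Eventually.of_forall fun k => hbd k x)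
        dsimp only
        gcongr
        rw [← ofReal_norm]
        apply ENNReal.ofReal_le_ofReal
        rw [Real.norm_eq_abs]
        linarith [abs_sub (ballAvg r (w (φ k)) x) (c * a x), hbd k x]
      · have h2 := ((hpt x).sub_const (c * a x)).enorm
        rw [sub_self, enorm_zero] at h2
        have h3 := (ENNReal.continuous_pow 2).continuousAt.tendsto.comp h2
        simpa [Function.comp_def] using h3
    rw [lintegral_zero] at h1
    have h2 := h1.ennrpow_const (1 / 2)
    rw [ENNReal.zero_rpow_of_pos (by norm_num)] at h2
    refine h2.congr fun k => ?_
    rw [eLpNorm_eq_lintegral_rpow_enorm_toReal (by norm_num) (by norm_num)]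
    simp
  obtain ⟨N, hN⟩ := eventually_atTop.1 (hL2.eventually_lt_const hε'0)
  refine ⟨N, fun j hj k hk => ?_⟩
  have hm := X₀.sub (hw (φ j)) (hw (φ k))
  -- The averaging error of the difference, plus the distances of the two averages to their common
  -- limit: one ε' each.
  have e : w (φ j) - w (φ k) = ((w (φ j) - w (φ k)) - ballAvg r (w (φ j) - w (φ k))) +
      ((ballAvg r (w (φ j)) - fun x => c * a x) - (ballAvg r (w (φ k)) - fun x => c * a x)) := by
    rw [ballAvg_sub hr (hw' j) (hw' k)]; abel
  rw [e]
  refine lt_of_le_of_lt ?_ hε'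
  refine (eLpNorm_add_le ?_ (((hmeas j).sub hmeas').sub ((hmeas k).sub hmeas')) (by norm_num)).trans
    (add_le_add (hdiff j k) ?_)
  · exact hm.1.2.1.1.sub (aestronglyMeasurable_ballAvg hr hm.1.1).restrict
  · exact (eLpNorm_sub_le ((hmeas j).sub hmeas') ((hmeas k).sub hmeas') (by norm_num)).trans
      (add_le_add (hN j hj).le (hN k hk).le)

/-- Compact embedding of `X₀` in `L¹(Ω)`, with a.e. convergence. -/
lemma Admissible.exists_subseq_tendsto (h : Admissible s K Ω)
    {w : ℕ → EuclideanSpace ℝ (Fin n) → ℝ} (hw : ∀ k, w k ∈ X₀ K Ω) {R : ℝ}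
    (hwR : ∀ k, normX₀ K Ω (w k) ≤ R) :
    ∃ φ : ℕ → ℕ, StrictMono φ ∧ ∃ u : EuclideanSpace ℝ (Fin n) → ℝ,
      (∀ᵐ x ∂volume, Tendsto (fun k => w (φ k) x) atTop (𝓝 (u x))) ∧
      Tendsto (fun k => ∫ x in Ω, |w (φ k) x - u x|) atTop (𝓝 0) := by
  have hfin := h.isFiniteMeasure
  obtain ⟨φ, hφ, hc⟩ := h.exists_subseq_cauchy hw hwR
  have : Fact ((1 : ℝ≥0∞) ≤ 2) := ⟨by norm_num⟩
  have hcau : CauchySeq fun k => (hw (φ k)).1.2.1.toLp := by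
    rw [EMetric.cauchySeq_iff]
    intro ε hε
    obtain ⟨N, hN⟩ := hc ε hε
    exact ⟨N, fun j hj k hk => by rw [Lp.edist_toLp_toLp]; exact hN j hj k hk⟩
  obtain ⟨f, hf⟩ := cauchySeq_tendsto_of_complete hcau
  have hf1 : Tendsto (fun k => eLpNorm (w (φ k) - ⇑f) 2 (volume.restrict Ω)) atTop (𝓝 0) := by
    have h1 := tendsto_iff_edist_tendsto_0.1 hf
    refine h1.congr fun k => ?_
    rw [Lp.edist_def]
    exact eLpNorm_congr_ae ((hw (φ k)).1.2.1.coeFn_toLp.sub EventuallyEq.rfl)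
  have hmw : ∀ k, AEStronglyMeasurable (w (φ k)) (volume.restrict Ω) := fun k => (hw _).1.2.1.1
  have hmf : AEStronglyMeasurable f (volume.restrict Ω) := (Lp.memLp f).1
  obtain ⟨ψ, hψ, hae⟩ := (tendstoInMeasure_of_tendsto_eLpNorm (by norm_num) hmw hmf
    hf1).exists_seq_tendsto_ae
  -- Extension by zero turns a.e. convergence in Ω into a.e. convergence in the whole space.
  refine ⟨φ ∘ ψ, hφ.comp hψ, Ω.indicator f, ?_, ?_⟩
  · rw [ae_restrict_iff' h.measurableSet] at hae
    filter_upwards [hae, ae_all_iff.2 fun k => (hw k).2] with x hx hx0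
    by_cases hxΩ : x ∈ Ω
    · simpa [hxΩ] using hx hxΩ
    · simp [hxΩ, hx0 _ hxΩ]
  · have h1 : Tendsto (fun k => eLpNorm (w (φ (ψ k)) - ⇑f) 1 (volume.restrict Ω)) atTop (𝓝 0) := by
      have h2 := ENNReal.Tendsto.mul_const (b := volume.restrict Ω univ ^ (1 / (1 : ℝ≥0∞).toReal -
        1 / (2 : ℝ≥0∞).toReal)) (hf1.comp hψ.tendsto_atTop) (Or.inr (by
          refine ENNReal.rpow_ne_top_of_nonneg (by norm_num) (measure_ne_top _ _)))
      rw [zero_mul] at h2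
      exact tendsto_of_tendsto_of_tendsto_of_le_of_le tendsto_const_nhds h2 (fun _ => zero_le)
        fun k => eLpNorm_le_eLpNorm_mul_rpow_measure_univ (by norm_num) ((hmw _).sub hmf)
    have h3 := (ENNReal.tendsto_toReal ENNReal.zero_ne_top).comp h1
    refine h3.congr fun k => ?_
    rw [Function.comp_apply, eLpNorm_one_eq_lintegral_enorm,
      ← integral_norm_eq_lintegral_enorm ((hmw _).sub hmf)]
    refine setIntegral_congr_fun h.measurableSet fun x hx => ?_
    simp [hx]

end Compactness

/-! ### Scalar inequalities for powers and for the primitive of g. -/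

section Pointwise

/-- Bernoulli's inequality for (x/y)^{p-1}, multiplied by y^{p-1}. -/
lemma rpow_sub_one_sub_le {p x y : ℝ} (hp : 2 ≤ p) (hx : 0 ≤ x) (hxy : x ≤ y) :
    y ^ (p - 1) - x ^ (p - 1) ≤ (p - 1) * y ^ (p - 2) * (y - x) := by
  rcases hx.eq_or_lt with rfl | hx0
  · rcases hxy.eq_or_lt with rfl | hy
    · simp
    · rw [Real.zero_rpow (by linarith), sub_zero, sub_zero]
      have : y ^ (p - 1) = y ^ (p - 2) * y := by
        rw [← Real.rpow_add_one hy.ne']; congr 1; ring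
      rw [this]
      have : 0 ≤ y ^ (p - 2) * y := by positivity
      nlinarith
  · have hy : 0 < y := hx0.trans_le hxy
    have h1 := one_add_mul_self_le_rpow_one_add (s := x / y - 1)
      (by have : 0 ≤ x / y := by positivity
          linarith) (p := p - 1) (by linarith)
    rw [add_sub_cancel, Real.div_rpow hx hy.le, le_div_iff₀ (by positivity)] at h1
    have : y ^ (p - 1) = y ^ (p - 2) * y := by
      rw [← Real.rpow_add_one hy.ne']; congr 1; ring
    have h2 : (1 + (p - 1) * (x / y - 1)) * y ^ (p - 1) =
        y ^ (p - 1) - (p - 1) * y ^ (p - 2) * (y - x) := by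
      rw [this]; field_simp; ring
    linarith

/-- A one-sided Lipschitz bound on [-R, R] for the derivative of |t|^p/p, split according to the
signs of x and y. -/
lemma abs_rpow_mul_sub_le {p R x y : ℝ} (hp : 2 ≤ p) (hx : |x| ≤ R) (hy : |y| ≤ R)
    (hxy : x ≤ y) :
    |y| ^ (p - 2) * y - |x| ^ (p - 2) * x ≤ (p - 1) * R ^ (p - 2) * (y - x) := by
  have key : ∀ a : ℝ, 0 ≤ a → a ^ (p - 2) * a = a ^ (p - 1) := fun a ha => by
    rcases ha.eq_or_lt with rfl | ha
    · rw [mul_zero, Real.zero_rpow (by linarith)]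
    · rw [← Real.rpow_add_one ha.ne']; congr 1; ring
  have hmono : ∀ a : ℝ, |a| ≤ R → |a| ^ (p - 2) ≤ R ^ (p - 2) := fun a ha =>
    Real.rpow_le_rpow (abs_nonneg a) ha (by linarith)
  have hRp : 0 ≤ R ^ (p - 2) := Real.rpow_nonneg ((abs_nonneg x).trans hx) _
  rcases le_total 0 x with h0 | h0
  · have h1 := rpow_sub_one_sub_le hp h0 hxy
    have h2 := hmono y hy
    rw [abs_of_nonneg (h0.trans hxy)] at h2 ⊢
    rw [abs_of_nonneg h0, key x h0, key y (h0.trans hxy)]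
    refine h1.trans ?_
    have : 0 ≤ p - 1 := by linarith
    have : 0 ≤ y - x := by linarith
    gcongr
  rcases le_total 0 y with h0' | h0'
  · have h1 := hmono x hx
    have h2 := hmono y hy
    have h3 : |y| ^ (p - 2) * y ≤ R ^ (p - 2) * y := by gcongr
    have h4 : |x| ^ (p - 2) * (-x) ≤ R ^ (p - 2) * (-x) :=
      mul_le_mul_of_nonneg_right h1 (by linarith)
    have h5 : R ^ (p - 2) * (y - x) ≤ (p - 1) * (R ^ (p - 2) * (y - x)) :=
      le_mul_of_one_le_left (mul_nonneg hRp (by linarith)) (by linarith)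
    nlinarith
  · have h1 := rpow_sub_one_sub_le hp (x := -y) (y := -x) (by linarith) (by linarith)
    have h2 := hmono x hx
    rw [abs_of_nonpos h0] at h2 ⊢
    rw [abs_of_nonpos h0']
    have e1 := key (-x) (by linarith)
    have e2 := key (-y) (by linarith)
    calc (-y) ^ (p - 2) * y - (-x) ^ (p - 2) * x = (-x) ^ (p - 1) - (-y) ^ (p - 1) := by
          rw [← e1, ← e2]; ring
      _ ≤ (p - 1) * (-x) ^ (p - 2) * (-x - -y) := h1
      _ = (p - 1) * (-x) ^ (p - 2) * (y - x) := by ring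
      _ ≤ _ := by
        have : 0 ≤ p - 1 := by linarith
        have : 0 ≤ y - x := by linarith
        gcongr

/-- With L = p(p-1)R^{p-2}, the function (L/2)t² - |t|^p has a monotone derivative on [-R, R], so it
is convex. Its midpoint inequality gives the claim even with L/8 in place of L. -/
lemma abs_rpow_midpoint_le {p : ℝ} (hp : 2 ≤ p) (a b : ℝ) :
    |a| ^ p / 2 + |b| ^ p / 2 - |1 / 2 * (a + b)| ^ p ≤
      p * (p - 1) * ((|a| + |b|) ^ (p - 2) * |a - b| ^ (2 : ℝ)) := by
  set R := |a| + |b| with hR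
  set L := p * (p - 1) * R ^ (p - 2) with hL
  have hLnn : 0 ≤ L := by
    have : 0 ≤ p - 1 := by linarith
    positivity
  have hd : ∀ t : ℝ, HasDerivAt (fun t : ℝ => L / 2 * t ^ 2 - |t| ^ p)
      (L * t - p * |t| ^ (p - 2) * t) t := fun t => by
    have h1 := ((hasDerivAt_pow 2 t).const_mul (L / 2)).sub
      (hasDerivAt_abs_rpow t (by linarith : 1 < p))
    convert! h1 using 1
    push_cast; ring
  have hconv : ConvexOn ℝ (Icc (-R) R) (fun t : ℝ => L / 2 * t ^ 2 - |t| ^ p) := by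
    refine MonotoneOn.convexOn_of_deriv (convex_Icc _ _)
      (fun t _ => (hd t).continuousAt.continuousWithinAt)
      (fun t _ => (hd t).differentiableAt.differentiableWithinAt) ?_
    intro x hx y hy hxy
    rw [(hd x).deriv, (hd y).deriv]
    have hx' : |x| ≤ R := abs_le.2 (mem_Icc.1 (interior_subset hx))
    have hy' : |y| ≤ R := abs_le.2 (mem_Icc.1 (interior_subset hy))
    have := mul_le_mul_of_nonneg_left (abs_rpow_mul_sub_le hp hx' hy' hxy)
      (by linarith : 0 ≤ p)
    rw [hL]
    linarith
  have ha : a ∈ Icc (-R) R := abs_le.1 (by rw [hR]; linarith [abs_nonneg b])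
  have hb : b ∈ Icc (-R) R := abs_le.1 (by rw [hR]; linarith [abs_nonneg a])
  have h1 := hconv.2 ha hb (by norm_num : (0 : ℝ) ≤ 1 / 2) (by norm_num : (0 : ℝ) ≤ 1 / 2)
    (by norm_num)
  simp only [smul_eq_mul, ← mul_add] at h1
  have h2 : |a - b| ^ (2 : ℝ) = (a - b) ^ 2 := by rw [Real.rpow_two, sq_abs]
  rw [h2, ← mul_assoc, ← hL]
  nlinarith [mul_nonneg hLnn (sq_nonneg (a - b))]

/-- A crude weighted Young inequality replacing Hölder: after integration only p-th powers remain,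
normalized by the bounds α and β on the two factors. -/
lemma rpow_mul_sq_le {p x y α β : ℝ} (hp : 2 ≤ p) (hx : 0 ≤ x) (hy : 0 ≤ y) (hα : 0 < α)
    (hβ : 0 < β) :
    x ^ (p - 2) * y ^ (2 : ℝ) ≤
      α ^ (p - 2) * β ^ (2 : ℝ) * (x ^ p / α ^ p + y ^ p / β ^ p) := by
  have key : ∀ a b : ℝ, 0 ≤ a → 0 ≤ b → a ^ (p - 2) * b ^ (2 : ℝ) ≤ a ^ p + b ^ p := by
    intro a b ha hb
    have e : ∀ c : ℝ, 0 ≤ c → c ^ (p - 2) * c ^ (2 : ℝ) = c ^ p := fun c hc => by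
      rw [← Real.rpow_add_of_nonneg hc (by linarith) (by norm_num)]; congr 1; ring
    rcases le_total a b with hab | hab
    · calc a ^ (p - 2) * b ^ (2 : ℝ) ≤ b ^ (p - 2) * b ^ (2 : ℝ) := by
            gcongr
        _ = b ^ p := e b hb
        _ ≤ _ := le_add_of_nonneg_left (by positivity)
    · calc a ^ (p - 2) * b ^ (2 : ℝ) ≤ a ^ (p - 2) * a ^ (2 : ℝ) := by gcongr
        _ = a ^ p := e a ha
        _ ≤ _ := le_add_of_nonneg_right (by positivity)
  have h1 := key (x / α) (y / β) (by positivity) (by positivity)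
  rw [Real.div_rpow hx hα.le, Real.div_rpow hx hα.le, Real.div_rpow hy hβ.le,
    Real.div_rpow hy hβ.le] at h1
  have h2 : 0 < α ^ (p - 2) * β ^ (2 : ℝ) := by positivity
  calc x ^ (p - 2) * y ^ (2 : ℝ) = α ^ (p - 2) * β ^ (2 : ℝ) *
        (x ^ (p - 2) / α ^ (p - 2) * (y ^ (2 : ℝ) / β ^ (2 : ℝ))) := by field_simp
    _ ≤ _ := by gcongr

lemma add_rpow_le_two_rpow {p a b : ℝ} (hp : 0 ≤ p) (ha : 0 ≤ a) (hb : 0 ≤ b) :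
    (a + b) ^ p ≤ 2 ^ p * (a ^ p + b ^ p) := by
  rcases le_total a b with hab | hab
  · calc (a + b) ^ p ≤ (2 * b) ^ p := by gcongr; linarith
      _ = 2 ^ p * b ^ p := Real.mul_rpow (by norm_num) hb
      _ ≤ _ := by gcongr; exact le_add_of_nonneg_left (by positivity)
  · calc (a + b) ^ p ≤ (2 * a) ^ p := by gcongr; linarith
      _ = 2 ^ p * a ^ p := Real.mul_rpow (by norm_num) ha
      _ ≤ _ := by gcongr; exact le_add_of_nonneg_right (by positivity)

variable {g : ℝ → ℝ} {a₁ a₂ q p : ℝ}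

lemma primitive_sub (hg : Continuous g) (a b : ℝ) :
    primitive g a - primitive g b = ∫ τ in b..a, g τ :=
  intervalIntegral.integral_interval_sub_left (hg.intervalIntegrable _ _)
    (hg.intervalIntegrable _ _)

lemma primitive_zero (g : ℝ → ℝ) : primitive g 0 = 0 := by simp [primitive]

lemma hasDerivAt_primitive (hg : Continuous g) (t : ℝ) : HasDerivAt (primitive g) (g t) t :=
  intervalIntegral.integral_hasDerivAt_right (hg.intervalIntegrable _ _)
    (hg.stronglyMeasurableAtFilter _ _) hg.continuousAt

lemma continuous_primitive (hg : Continuous g) : Continuous (primitive g) :=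
  continuous_iff_continuousAt.2 fun t => (hasDerivAt_primitive hg t).continuousAt

/-- A subcritical growth bound is below any multiple of the critical power, up to a constant. -/
lemma exists_growth_le (ha₁ : 0 < a₁) (ha₂ : 0 < a₂) (hq : 1 ≤ q) (hqp : q < p)
    (hg1 : ∀ t, |g t| ≤ a₁ + a₂ * |t| ^ (q - 1)) {ε : ℝ} (hε : 0 < ε) :
    ∃ C : ℝ, 0 < C ∧ ∀ t, |g t| ≤ C + ε * |t| ^ (p - 1) := by
  -- Beyond this threshold a₂|t|^{q-1} ≤ ε|t|^{p-1}.
  set T := (a₂ / ε) ^ (1 / (p - q)) with hT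
  have hT0 : 0 < T := by positivity
  refine ⟨a₁ + a₂ * T ^ (q - 1), by positivity, fun t => (hg1 t).trans ?_⟩
  rcases le_total |t| T with h | h
  · have h1 : |t| ^ (q - 1) ≤ T ^ (q - 1) := Real.rpow_le_rpow (abs_nonneg _) h (by linarith)
    have h2 : 0 ≤ ε * |t| ^ (p - 1) := by positivity
    nlinarith
  · have ht : 0 < |t| := hT0.trans_le h
    have h1 : a₂ / ε ≤ |t| ^ (p - q) := by
      have h2 := Real.rpow_le_rpow hT0.le h (by linarith : 0 ≤ p - q)
      rwa [hT, ← Real.rpow_mul (by positivity), one_div, inv_mul_cancel₀ (by linarith),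
        Real.rpow_one] at h2
    rw [div_le_iff₀ hε] at h1
    have h3 : |t| ^ (p - 1) = |t| ^ (p - q) * |t| ^ (q - 1) := by
      rw [← Real.rpow_add ht]; congr 1; ring
    have h4 : a₂ * |t| ^ (q - 1) ≤ ε * |t| ^ (p - 1) := by
      rw [h3]
      calc a₂ * |t| ^ (q - 1) ≤ |t| ^ (p - q) * ε * |t| ^ (q - 1) := by gcongr
        _ = _ := by ring
    have : 0 ≤ a₂ * T ^ (q - 1) := by positivity
    linarith

/-- Subcriticality enters here: the increment of G is linear in |a - b|, apart from a critical
remainder whose coefficient is as small as desired. -/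
lemma exists_primitive_sub_le (hg : Continuous g) (ha₁ : 0 < a₁) (ha₂ : 0 < a₂) (hq : 1 ≤ q)
    (hqp : q < p) (hg1 : ∀ t, |g t| ≤ a₁ + a₂ * |t| ^ (q - 1)) {ε : ℝ} (hε : 0 < ε) :
    ∃ C : ℝ, 0 < C ∧ ∀ a b, |primitive g a - primitive g b| ≤
      C * |a - b| + ε * (|a| ^ p + |b| ^ p) := by
  obtain ⟨C, hC, H⟩ := exists_growth_le ha₁ ha₂ hq hqp hg1 (half_pos hε)
  refine ⟨C, hC, fun a b => ?_⟩
  set m := max |a| |b| with hm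
  have hm0 : 0 ≤ m := (abs_nonneg a).trans (le_max_left _ _)
  have h1 : |primitive g a - primitive g b| ≤ (C + ε / 2 * m ^ (p - 1)) * |a - b| := by
    rw [primitive_sub hg, ← Real.norm_eq_abs]
    refine intervalIntegral.norm_integral_le_of_norm_le_const fun t ht => ?_
    refine (Real.norm_eq_abs (g t)).trans_le ((H t).trans ?_)
    have : |t| ≤ m := by
      rw [Set.uIoc, Set.mem_Ioc] at ht
      have h1 := abs_le.1 (le_max_left |a| |b|)
      have h2 := abs_le.1 (le_max_right |a| |b|)
      rw [abs_le]
      exact ⟨(le_min h2.1 h1.1).trans ht.1.le, ht.2.trans (max_le h2.2 h1.2)⟩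
    gcongr
    linarith
  have h2 : m ^ (p - 1) * |a - b| ≤ 2 * m ^ p := by
    have h3 : |a - b| ≤ 2 * m := by
      linarith [abs_sub a b, le_max_left |a| |b|, le_max_right |a| |b|]
    have h4 : m ^ (p - 1) * m = m ^ p := by
      rcases hm0.eq_or_lt with h0 | h0
      · rw [← h0, mul_zero, Real.zero_rpow (by linarith)]
      · rw [← Real.rpow_add_one h0.ne']; congr 1; ring
    calc m ^ (p - 1) * |a - b| ≤ m ^ (p - 1) * (2 * m) := by gcongr
      _ = 2 * m ^ p := by rw [← h4]; ring
  have h5 : m ^ p ≤ |a| ^ p + |b| ^ p := by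
    rcases max_choice |a| |b| with h | h <;> rw [hm, h]
    · exact le_add_of_nonneg_right (by positivity)
    · exact le_add_of_nonneg_left (by positivity)
  nlinarith

end Pointwise

/-! ### The critical and subcritical integral functionals on bounded sets. -/

section Functionals

variable {n : ℕ} {s : ℝ} {K : EuclideanSpace ℝ (Fin n) → ℝ}
  {Ω : Set (EuclideanSpace ℝ (Fin n))} {u v : EuclideanSpace ℝ (Fin n) → ℝ}
  {g : ℝ → ℝ} {a₁ a₂ q : ℝ}

lemma Admissible.twoStar_pos (h : Admissible s K Ω) : 0 < twoStar n s :=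
  NonlocalCritical.twoStar_pos h.s_pos h.two_s_lt

lemma Admissible.two_lt_twoStar (h : Admissible s K Ω) : 2 < twoStar n s :=
  NonlocalCritical.two_lt_twoStar h.s_pos h.two_s_lt

lemma Admissible.memLp_twoStar (h : Admissible s K Ω) (hu : u ∈ X₀ K Ω) :
    MemLp u (ENNReal.ofReal (twoStar n s)) (volume.restrict Ω) := by
  obtain ⟨A, -, H⟩ := h.exists_sobolev_normX₀
  exact MemLp.restrict Ω ⟨hu.1.1.aestronglyMeasurable, (H u hu).trans_lt ENNReal.ofReal_lt_top⟩

/-- The `L^{2^*}(Ω)` norm as a real number. -/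
noncomputable def critNorm (s : ℝ) (Ω : Set (EuclideanSpace ℝ (Fin n)))
    (u : EuclideanSpace ℝ (Fin n) → ℝ) : ℝ :=
  (eLpNorm u (ENNReal.ofReal (twoStar n s)) (volume.restrict Ω)).toReal

lemma MemLp.integrable_abs_rpow {α : Type*} [MeasurableSpace α] {m : Measure α} {f : α → ℝ} {p : ℝ}
    (hp : 0 < p) (hf : MemLp f (ENNReal.ofReal p) m) : Integrable (fun x => |f x| ^ p) m := by
  have := hf.integrable_norm_rpow (by simpa using hp) ENNReal.ofReal_ne_top
  simpa [ENNReal.toReal_ofReal hp.le] using this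

lemma Admissible.integrableOn_rpow (h : Admissible s K Ω) (hu : u ∈ X₀ K Ω) :
    IntegrableOn (fun x => |u x| ^ twoStar n s) Ω :=
  MemLp.integrable_abs_rpow h.twoStar_pos (h.memLp_twoStar hu)

lemma Admissible.integral_rpow_eq (h : Admissible s K Ω) (hu : u ∈ X₀ K Ω) :
    ∫ x in Ω, |u x| ^ twoStar n s = critNorm s Ω u ^ twoStar n s := by
  have hp := h.twoStar_pos
  rw [critNorm, (h.memLp_twoStar hu).eLpNorm_eq_integral_rpow_norm (by simpa using hp)
    ENNReal.ofReal_ne_top, ENNReal.toReal_ofReal hp.le, ENNReal.toReal_ofReal (by positivity),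
    ← Real.rpow_mul (by positivity), inv_mul_cancel₀ hp.ne', Real.rpow_one]
  rfl

lemma Admissible.exists_critNorm_le (h : Admissible s K Ω) :
    ∃ A : ℝ, 0 < A ∧ ∀ u ∈ X₀ K Ω, critNorm s Ω u ≤ A * normX₀ K Ω u := by
  obtain ⟨A, hA, H⟩ := h.exists_sobolev_normX₀
  refine ⟨A, hA, fun u hu => ENNReal.toReal_le_of_le_ofReal ?_ ?_⟩
  · have := normX₀_nonneg (K := K) (Ω := Ω) u
    positivity
  · exact (eLpNorm_restrict_le _ _ _ _).trans (H u hu)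

lemma Admissible.exists_integral_rpow_le (h : Admissible s K Ω) :
    ∃ A : ℝ, 0 < A ∧ ∀ u ∈ X₀ K Ω,
      ∫ x in Ω, |u x| ^ twoStar n s ≤ A * normX₀ K Ω u ^ twoStar n s := by
  obtain ⟨A, hA, H⟩ := h.exists_critNorm_le
  refine ⟨A ^ twoStar n s, by positivity, fun u hu => ?_⟩
  rw [h.integral_rpow_eq hu, ← Real.mul_rpow hA.le (normX₀_nonneg u)]
  exact Real.rpow_le_rpow ENNReal.toReal_nonneg (H u hu) h.twoStar_pos.le

lemma Admissible.critNorm_le_add (h : Admissible s K Ω) (hu : u ∈ X₀ K Ω) (hv : v ∈ X₀ K Ω) :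
    critNorm s Ω u ≤ critNorm s Ω v + critNorm s Ω (u - v) := by
  have h1 := h.memLp_twoStar hv
  have h2 := h.memLp_twoStar (X₀.sub hu hv)
  rw [critNorm, critNorm, critNorm, ← ENNReal.toReal_add h1.2.ne h2.2.ne]
  refine ENNReal.toReal_mono (ENNReal.add_ne_top.2 ⟨h1.2.ne, h2.2.ne⟩) ?_
  have e : u = v + (u - v) := by abel
  nth_rw 1 [e]
  refine eLpNorm_add_le h1.1 h2.1 ?_
  rw [ENNReal.one_le_ofReal]
  linarith [h.two_lt_twoStar]

/-- Quantitative almost-convexity of the critical term at midpoints. -/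
lemma Admissible.exists_midpoint_le (h : Admissible s K Ω) :
    ∃ A : ℝ, 0 < A ∧ ∀ ρ : ℝ, 0 < ρ → ∀ u ∈ X₀ K Ω, ∀ v ∈ X₀ K Ω,
      normX₀ K Ω u ≤ ρ → normX₀ K Ω v ≤ ρ →
      (∫ x in Ω, |u x| ^ twoStar n s) / 2 + (∫ x in Ω, |v x| ^ twoStar n s) / 2 -
        ∫ x in Ω, |((1 / 2 : ℝ) • (u + v)) x| ^ twoStar n s ≤
      A * ρ ^ (twoStar n s - 2) * normX₀ K Ω (u - v) ^ 2 := by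
  obtain ⟨A, hA, H⟩ := h.exists_integral_rpow_le
  have hp0 := h.twoStar_pos
  have hp2 := h.two_lt_twoStar
  set p := twoStar n s with hp
  have hpp : 0 < p * (p - 1) := mul_pos hp0 (by linarith)
  refine ⟨p * (p - 1) * (2 ^ p * (A + A) + A), by positivity, fun ρ hρ u hu v hv huρ hvρ => ?_⟩
  have hm : (1 / 2 : ℝ) • (u + v) ∈ X₀ K Ω := X₀.smul (X₀.add hu hv) _
  have hd := X₀.sub hu hv
  have iu := h.integrableOn_rpow hu
  have iv := h.integrableOn_rpow hv
  have im := h.integrableOn_rpow hm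
  have id := h.integrableOn_rpow hd
  rw [← hp] at iu iv im id
  have i2 : IntegrableOn (fun x => |u x| ^ p / 2 + |v x| ^ p / 2) Ω :=
    (iu.div_const 2).add (iv.div_const 2)
  have i3 : IntegrableOn (fun x => |u x| ^ p + |v x| ^ p) Ω := iu.add iv
  set δ := normX₀ K Ω (u - v) with hδ
  have hδ0 : 0 ≤ δ := normX₀_nonneg _
  have hJ : ∀ w ∈ X₀ K Ω, normX₀ K Ω w ≤ ρ → ∫ x in Ω, |w x| ^ p ≤ A * ρ ^ p :=
    fun w hw hwρ => (H w hw).trans (by have := normX₀_nonneg (K := K) (Ω := Ω) w; gcongr)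
  have hlhs : (∫ x in Ω, |u x| ^ p) / 2 + (∫ x in Ω, |v x| ^ p) / 2 -
      ∫ x in Ω, |((1 / 2 : ℝ) • (u + v)) x| ^ p =
      ∫ x in Ω, (|u x| ^ p / 2 + |v x| ^ p / 2 - |((1 / 2 : ℝ) • (u + v)) x| ^ p) := by
    rw [integral_sub i2 im,
      integral_add (iu.div_const 2) (iv.div_const 2), integral_div, integral_div]
  -- Young's inequality divides by β^p, so β > 0 stands in for δ, which may vanish; letting β
  -- decrease to δ recovers the bound.
  have key : ∀ β : ℝ, 0 < β → δ ≤ β →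
      (∫ x in Ω, |u x| ^ p) / 2 + (∫ x in Ω, |v x| ^ p) / 2 -
        ∫ x in Ω, |((1 / 2 : ℝ) • (u + v)) x| ^ p ≤
      p * (p - 1) * (2 ^ p * (A + A) + A) * ρ ^ (p - 2) * β ^ 2 := by
    intro β hβ hδβ
    rw [hlhs]
    have hpt : ∀ x, |u x| ^ p / 2 + |v x| ^ p / 2 - |((1 / 2 : ℝ) • (u + v)) x| ^ p ≤
        p * (p - 1) * (ρ ^ (p - 2) * β ^ (2 : ℝ)) *
          (2 ^ p / ρ ^ p * (|u x| ^ p + |v x| ^ p) + |(u - v) x| ^ p / β ^ p) := fun x => by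
      refine (abs_rpow_midpoint_le hp2.le (u x) (v x)).trans ?_
      rw [mul_assoc (p * (p - 1))]
      refine mul_le_mul_of_nonneg_left ?_ hpp.le
      refine (rpow_mul_sq_le hp2.le (by positivity) (abs_nonneg _) hρ hβ).trans ?_
      refine mul_le_mul_of_nonneg_left ?_ (by positivity)
      refine add_le_add ?_ le_rfl
      rw [div_mul_eq_mul_div]
      exact div_le_div_of_nonneg_right
        (add_rpow_le_two_rpow hp0.le (abs_nonneg _) (abs_nonneg _)) (by positivity)
    refine (integral_mono (i2.sub im)
      (((i3.const_mul _).add (id.div_const _)).const_mul _) hpt).trans ?_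
    rw [integral_const_mul]
    have e1 : ∫ x in Ω, ((fun x => 2 ^ p / ρ ^ p * (|u x| ^ p + |v x| ^ p)) x +
        (fun x => |(u - v) x| ^ p / β ^ p) x) =
        2 ^ p / ρ ^ p * ((∫ x in Ω, |u x| ^ p) + ∫ x in Ω, |v x| ^ p) +
          (∫ x in Ω, |(u - v) x| ^ p) / β ^ p := by
      rw [integral_add (i3.const_mul _) (id.div_const _), integral_const_mul,
        integral_add iu iv, integral_div]
    have hu' := hJ u hu huρ
    have hv' := hJ v hv hvρ
    have hd' : ∫ x in Ω, |(u - v) x| ^ p ≤ A * β ^ p := (H _ hd).trans (by gcongr)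
    calc p * (p - 1) * (ρ ^ (p - 2) * β ^ (2 : ℝ)) * ∫ x in Ω,
          (2 ^ p / ρ ^ p * (|u x| ^ p + |v x| ^ p) + |(u - v) x| ^ p / β ^ p)
        = p * (p - 1) * (ρ ^ (p - 2) * β ^ (2 : ℝ)) *
          (2 ^ p / ρ ^ p * ((∫ x in Ω, |u x| ^ p) + ∫ x in Ω, |v x| ^ p) +
          (∫ x in Ω, |(u - v) x| ^ p) / β ^ p) := by rw [← e1]
      _ ≤ p * (p - 1) * (ρ ^ (p - 2) * β ^ (2 : ℝ)) *
          (2 ^ p / ρ ^ p * (A * ρ ^ p + A * ρ ^ p) + A * β ^ p / β ^ p) := by gcongr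
      _ = _ := by rw [Real.rpow_two]; field_simp
  have hlim : Tendsto (fun β : ℝ => p * (p - 1) * (2 ^ p * (A + A) + A) * ρ ^ (p - 2) * β ^ 2)
      (𝓝[>] δ) (𝓝 (p * (p - 1) * (2 ^ p * (A + A) + A) * ρ ^ (p - 2) * δ ^ 2)) :=
    ((continuous_const.mul (continuous_pow 2)).tendsto δ).mono_left nhdsWithin_le_nhds
  refine ge_of_tendsto hlim ?_
  filter_upwards [self_mem_nhdsWithin] with β hβ
  exact key β (hδ0.trans_lt hβ) (le_of_lt hβ)

lemma Admissible.integrableOn_primitive (h : Admissible s K Ω) (hg : Continuous g) (ha₁ : 0 < a₁)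
    (ha₂ : 0 < a₂) (hq : 1 ≤ q) (hqp : q < twoStar n s)
    (hg1 : ∀ t, |g t| ≤ a₁ + a₂ * |t| ^ (q - 1)) (hu : u ∈ X₀ K Ω) :
    IntegrableOn (fun x => primitive g (u x)) Ω := by
  obtain ⟨C, hC, H⟩ := exists_primitive_sub_le hg ha₁ ha₂ hq hqp hg1 one_pos
  have hp0 := h.twoStar_pos
  refine Integrable.mono' (g := fun x => C * |u x| + |u x| ^ twoStar n s)
    (((h.integrable_of_mem hu).integrableOn.abs.const_mul C).add (h.integrableOn_rpow hu)) ?_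
    (ae_of_all _ fun x => ?_)
  · exact (continuous_primitive hg).comp_aestronglyMeasurable hu.1.1.aestronglyMeasurable.restrict
  · have := H (u x) 0
    simpa [primitive_zero, Real.zero_rpow hp0.ne'] using this

/-- On a ball of `X₀` the critical integrals are bounded, so the small critical remainder becomes ε
and only the L¹ distance, governed by the compact embedding, is left. -/
lemma Admissible.exists_integral_primitive_sub_le (h : Admissible s K Ω) (hg : Continuous g)
    (ha₁ : 0 < a₁) (ha₂ : 0 < a₂) (hq : 1 ≤ q) (hqp : q < twoStar n s)
    (hg1 : ∀ t, |g t| ≤ a₁ + a₂ * |t| ^ (q - 1)) {ρ : ℝ} (hρ : 0 < ρ) {ε : ℝ} (hε : 0 < ε) :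
    ∃ C : ℝ, 0 < C ∧ ∀ u ∈ X₀ K Ω, ∀ v ∈ X₀ K Ω, normX₀ K Ω u ≤ ρ → normX₀ K Ω v ≤ ρ →
      |(∫ x in Ω, primitive g (u x)) - ∫ x in Ω, primitive g (v x)| ≤
        C * (∫ x in Ω, |u x - v x|) + ε := by
  obtain ⟨A, hA, HA⟩ := h.exists_integral_rpow_le
  have hp0 := h.twoStar_pos
  set p := twoStar n s with hp
  have hε' : 0 < ε / (A * ρ ^ p + A * ρ ^ p) := by positivity
  obtain ⟨C, hC, H⟩ := exists_primitive_sub_le hg ha₁ ha₂ hq hqp hg1 hε'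
  refine ⟨C, hC, fun u hu v hv huρ hvρ => ?_⟩
  have iu := h.integrableOn_rpow hu
  have iv := h.integrableOn_rpow hv
  have i3 : IntegrableOn (fun x => |u x| ^ p + |v x| ^ p) Ω := iu.add iv
  have id : IntegrableOn (fun x => |u x - v x|) Ω :=
    ((h.integrable_of_mem hu).sub (h.integrable_of_mem hv)).integrableOn.abs
  have hJ : ∀ w ∈ X₀ K Ω, normX₀ K Ω w ≤ ρ → ∫ x in Ω, |w x| ^ p ≤ A * ρ ^ p :=
    fun w hw hwρ => (HA w hw).trans (by have := normX₀_nonneg (K := K) (Ω := Ω) w; gcongr)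
  have hu' := hJ u hu huρ
  have hv' := hJ v hv hvρ
  rw [← integral_sub (h.integrableOn_primitive hg ha₁ ha₂ hq hqp hg1 hu)
    (h.integrableOn_primitive hg ha₁ ha₂ hq hqp hg1 hv)]
  refine (abs_integral_le_integral_abs).trans ?_
  refine (integral_mono_of_nonneg (ae_of_all _ fun x => abs_nonneg _)
    ((id.const_mul C).add (i3.const_mul _)) (ae_of_all _ fun x => H (u x) (v x))).trans ?_
  have e : ∫ x in Ω, (C * |u x - v x| + ε / (A * ρ ^ p + A * ρ ^ p) * (|u x| ^ p + |v x| ^ p)) =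
      C * (∫ x in Ω, |u x - v x|) + ε / (A * ρ ^ p + A * ρ ^ p) *
        ((∫ x in Ω, |u x| ^ p) + ∫ x in Ω, |v x| ^ p) := by
    rw [integral_add (id.const_mul C) (i3.const_mul _), integral_const_mul,
      integral_const_mul, integral_add iu iv]
  refine e.trans_le ?_
  refine add_le_add le_rfl ?_
  calc ε / (A * ρ ^ p + A * ρ ^ p) * ((∫ x in Ω, |u x| ^ p) + ∫ x in Ω, |v x| ^ p)
      ≤ ε / (A * ρ ^ p + A * ρ ^ p) * (A * ρ ^ p + A * ρ ^ p) := by gcongr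
    _ = ε := div_mul_cancel₀ _ (by positivity)

end Functionals

/-! ### Existence of minimizers on small balls. -/

section Minimization

variable {n : ℕ} {s : ℝ} {K : EuclideanSpace ℝ (Fin n) → ℝ}
  {Ω : Set (EuclideanSpace ℝ (Fin n))} {u v : EuclideanSpace ℝ (Fin n) → ℝ}
  {g : ℝ → ℝ} {a₁ a₂ q lam μ : ℝ}

lemma eventually_mul_rpow_lt {e : ℝ} (he : 0 < e) (c : ℝ) {d : ℝ} (hd : 0 < d) :
    ∀ᶠ ρ : ℝ in 𝓝[>] 0, c * ρ ^ e < d := by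
  have h1 := ((Real.continuousAt_rpow_const 0 e (Or.inr he.le)).tendsto.const_mul c).mono_left
    (nhdsWithin_le_nhds (s := Ioi 0))
  rw [Real.zero_rpow he.ne', mul_zero] at h1
  exact h1.eventually_lt_const hd

lemma Admissible.exists_abs_integral_primitive_le (h : Admissible s K Ω) (hg : Continuous g)
    (ha₁ : 0 < a₁) (ha₂ : 0 < a₂) (hq : 1 ≤ q) (hqp : q < twoStar n s)
    (hg1 : ∀ t, |g t| ≤ a₁ + a₂ * |t| ^ (q - 1)) {ρ : ℝ} (hρ : 0 < ρ) :
    ∃ M : ℝ, 0 < M ∧ ∀ u ∈ X₀ K Ω, normX₀ K Ω u ≤ ρ → |∫ x in Ω, primitive g (u x)| ≤ M := by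
  have hfin := h.isFiniteMeasure
  obtain ⟨C, hC, H⟩ := h.exists_integral_primitive_sub_le hg ha₁ ha₂ hq hqp hg1 hρ one_pos
  obtain ⟨A, hA, HA⟩ := h.exists_integral_rpow_le
  refine ⟨C * (volume.real Ω + A * ρ ^ twoStar n s) + 1, by positivity, fun u hu huρ => ?_⟩
  have h0 : normX₀ K Ω (0 : EuclideanSpace ℝ (Fin n) → ℝ) ≤ ρ := by
    simp [normX₀, hρ.le]
  have h1 := H u hu 0 X₀.zero huρ h0
  simp only [Pi.zero_apply, primitive_zero, integral_zero, sub_zero] at h1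
  refine h1.trans ?_
  gcongr
  have iu := h.integrableOn_rpow hu
  calc ∫ x in Ω, |u x| ≤ ∫ x in Ω, (1 + |u x| ^ twoStar n s) := by
        refine integral_mono (h.integrable_of_mem hu).integrableOn.abs
          ((integrable_const _).add iu) fun x => ?_
        rcases le_total |u x| 1 with hx | hx
        · exact hx.trans (le_add_of_nonneg_right (by positivity))
        · refine le_trans ?_ (le_add_of_nonneg_left zero_le_one)
          exact Real.self_le_rpow_of_one_le hx (by linarith [h.two_lt_twoStar])
    _ = volume.real Ω + ∫ x in Ω, |u x| ^ twoStar n s := by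
        rw [integral_add (integrable_const _) iu]; simp
    _ ≤ _ := by
        refine add_le_add le_rfl ((HA u hu).trans ?_)
        have := normX₀_nonneg (K := K) (Ω := Ω) u
        have := h.twoStar_pos
        gcongr

lemma Admissible.tendsto_integral_rpow (h : Admissible s K Ω)
    {w : ℕ → EuclideanSpace ℝ (Fin n) → ℝ} (hw : ∀ k, w k ∈ X₀ K Ω) (hu : u ∈ X₀ K Ω)
    (hlim : Tendsto (fun k => normX₀ K Ω (w k - u)) atTop (𝓝 0)) :
    Tendsto (fun k => ∫ x in Ω, |w k x| ^ twoStar n s) atTop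
      (𝓝 (∫ x in Ω, |u x| ^ twoStar n s)) := by
  obtain ⟨A, hA, H⟩ := h.exists_critNorm_le
  have h1 : Tendsto (fun k => critNorm s Ω (w k)) atTop (𝓝 (critNorm s Ω u)) := by
    rw [tendsto_iff_norm_sub_tendsto_zero]
    have h2 := hlim.const_mul A
    rw [mul_zero] at h2
    refine squeeze_zero (fun _ => norm_nonneg _) (fun k => ?_) h2
    rw [Real.norm_eq_abs, abs_sub_le_iff]
    have h3 := H _ (X₀.sub (hw k) hu)
    have h4 := H _ (X₀.sub hu (hw k))
    have h5 : normX₀ K Ω (u - w k) = normX₀ K Ω (w k - u) := by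
      rw [← neg_sub, ← neg_one_smul ℝ, normX₀_smul]; simp
    rw [h5] at h4
    constructor
    · linarith [h.critNorm_le_add (hw k) hu]
    · linarith [h.critNorm_le_add hu (hw k)]
  simp only [h.integral_rpow_eq (hw _), h.integral_rpow_eq hu]
  exact h1.rpow_const (Or.inr h.twoStar_pos.le)

lemma Admissible.tendsto_normX₀ (h : Admissible s K Ω)
    {w : ℕ → EuclideanSpace ℝ (Fin n) → ℝ} (hw : ∀ k, w k ∈ X₀ K Ω) (hu : u ∈ X₀ K Ω)
    (hlim : Tendsto (fun k => normX₀ K Ω (w k - u)) atTop (𝓝 0)) :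
    Tendsto (fun k => normX₀ K Ω (w k)) atTop (𝓝 (normX₀ K Ω u)) := by
  rw [tendsto_iff_norm_sub_tendsto_zero]
  refine squeeze_zero (fun _ => norm_nonneg _) (fun k => ?_) hlim
  have hd := X₀.sub (hw k) hu
  have h1 := h.normX₀_add_le hu hd
  have h2 := h.normX₀_sub_le (hw k) hd
  rw [add_sub_cancel] at h1
  rw [sub_sub_cancel] at h2
  rw [Real.norm_eq_abs, abs_sub_le_iff]
  constructor <;> linarith

lemma Admissible.tendsto_energy (h : Admissible s K Ω) (hg : Continuous g)
    (ha₁ : 0 < a₁) (ha₂ : 0 < a₂) (hq : 1 ≤ q) (hqp : q < twoStar n s)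
    (hg1 : ∀ t, |g t| ≤ a₁ + a₂ * |t| ^ (q - 1)) {ρ : ℝ} (hρ : 0 < ρ)
    {w : ℕ → EuclideanSpace ℝ (Fin n) → ℝ} (hw : ∀ k, w k ∈ X₀ K Ω)
    (hwρ : ∀ k, normX₀ K Ω (w k) ≤ ρ) (hu : u ∈ X₀ K Ω) (huρ : normX₀ K Ω u ≤ ρ)
    (hlim : Tendsto (fun k => normX₀ K Ω (w k - u)) atTop (𝓝 0))
    (hlim' : Tendsto (fun k => ∫ x in Ω, |w k x - u x|) atTop (𝓝 0)) :
    Tendsto (fun k => energy s K Ω g lam μ (w k)) atTop (𝓝 (energy s K Ω g lam μ u)) := by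
  have hG : Tendsto (fun k => ∫ x in Ω, primitive g (w k x)) atTop
      (𝓝 (∫ x in Ω, primitive g (u x))) := by
    rw [Metric.tendsto_atTop']
    intro ε hε
    obtain ⟨C, hC, H⟩ := h.exists_integral_primitive_sub_le hg ha₁ ha₂ hq hqp hg1 hρ (half_pos hε)
    have h1 := hlim'.const_mul C
    rw [mul_zero] at h1
    obtain ⟨N, hN⟩ := eventually_atTop.1 (h1.eventually_lt_const (half_pos hε))
    refine ⟨N, fun k hk => ?_⟩
    rw [Real.dist_eq]
    linarith [H _ (hw k) _ hu (hwρ k) huρ, hN k hk.le]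
  exact ((((h.tendsto_normX₀ hw hu hlim).pow 2).const_mul _).sub
    ((h.tendsto_integral_rpow hw hu hlim).const_mul _)).sub (hG.const_mul _)

/-- On small balls the energy is strongly convex at midpoints, up to the subcritical term. -/
lemma Admissible.eventually_normX₀_sub_sq_le (h : Admissible s K Ω) (hg : Continuous g)
    (ha₁ : 0 < a₁) (ha₂ : 0 < a₂) (hq : 1 ≤ q) (hqp : q < twoStar n s)
    (hg1 : ∀ t, |g t| ≤ a₁ + a₂ * |t| ^ (q - 1)) (hμ : 0 < μ) :
    ∀ᶠ ρ : ℝ in 𝓝[>] 0, ∀ lam : ℝ, 0 ≤ lam → ∀ ε : ℝ, 0 < ε → ∃ C : ℝ, 0 < C ∧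
      ∀ u ∈ X₀ K Ω, ∀ v ∈ X₀ K Ω, normX₀ K Ω u ≤ ρ → normX₀ K Ω v ≤ ρ →
      normX₀ K Ω (u - v) ^ 2 / 16 ≤
        energy s K Ω g lam μ u / 2 + energy s K Ω g lam μ v / 2 -
          energy s K Ω g lam μ ((1 / 2 : ℝ) • (u + v)) +
          lam * (C * (∫ x in Ω, |u x - v x|) + ε) := by
  obtain ⟨A, hA, HA⟩ := h.exists_midpoint_le
  have hp0 := h.twoStar_pos
  -- Half of the parallelogram term is ‖u - v‖²/8; for such ρ the critical term consumes at most ‖u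
  -- - v‖²/16 of it.
  filter_upwards [self_mem_nhdsWithin, eventually_mul_rpow_lt
    (sub_pos.2 h.two_lt_twoStar) (μ / twoStar n s * A) (by norm_num : (0 : ℝ) < 1 / 16)]
    with ρ hρ hρs lam hlam ε hε
  obtain ⟨C, hC, H⟩ := h.exists_integral_primitive_sub_le hg ha₁ ha₂ hq hqp hg1 hρ hε
  -- Each endpoint is at half the L¹ distance from the midpoint.
  refine ⟨C / 2, by positivity, fun u hu v hv huρ hvρ => ?_⟩
  have hm : (1 / 2 : ℝ) • (u + v) ∈ X₀ K Ω := X₀.smul (X₀.add hu hv) _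
  have hmρ : normX₀ K Ω ((1 / 2 : ℝ) • (u + v)) ≤ ρ := by
    rw [normX₀_smul, abs_of_pos (by norm_num)]
    linarith [h.normX₀_add_le hu hv]
  have h1 := h.normX₀_midpoint_sq hu hv
  have h2 := HA ρ hρ u hu v hv huρ hvρ
  have e1 : ∫ x in Ω, |u x - ((1 / 2 : ℝ) • (u + v)) x| = (∫ x in Ω, |u x - v x|) / 2 := by
    rw [← integral_div]
    congr 1; ext x
    rw [← abs_two, ← abs_div, abs_two]
    congr 1; simp only [Pi.smul_apply, Pi.add_apply, smul_eq_mul]; ring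
  have e2 : ∫ x in Ω, |v x - ((1 / 2 : ℝ) • (u + v)) x| = (∫ x in Ω, |u x - v x|) / 2 := by
    rw [← integral_div]
    congr 1; ext x
    rw [abs_sub_comm (u x), ← abs_two, ← abs_div, abs_two]
    congr 1; simp only [Pi.smul_apply, Pi.add_apply, smul_eq_mul]; ring
  have h3 := (abs_le.1 (H u hu _ hm huρ hmρ)).2
  have h4 := (abs_le.1 (H v hv _ hm hvρ hmρ)).2
  rw [e1] at h3
  rw [e2] at h4
  have h5 : μ / twoStar n s * ((∫ x in Ω, |u x| ^ twoStar n s) / 2 +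
      (∫ x in Ω, |v x| ^ twoStar n s) / 2 -
        ∫ x in Ω, |((1 / 2 : ℝ) • (u + v)) x| ^ twoStar n s) ≤
      1 / 16 * normX₀ K Ω (u - v) ^ 2 := by
    refine (mul_le_mul_of_nonneg_left h2 (by positivity)).trans ?_
    rw [← mul_assoc, ← mul_assoc]
    exact mul_le_mul_of_nonneg_right hρs.le (sq_nonneg _)
  set Gu := ∫ x in Ω, primitive g (u x)
  set Gv := ∫ x in Ω, primitive g (v x)
  set Gm := ∫ x in Ω, primitive g (((1 / 2 : ℝ) • (u + v)) x)
  have h6 : lam * (Gu / 2 + Gv / 2 - Gm) ≤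
      lam * (C / 2 * (∫ x in Ω, |u x - v x|) + ε) :=
    mul_le_mul_of_nonneg_left (by linarith) hlam
  unfold energy
  rw [h1]
  change _ ≤ (1 / 2 * normX₀ K Ω u ^ 2 - μ / twoStar n s * _ - lam * Gu) / 2 +
    (1 / 2 * normX₀ K Ω v ^ 2 - μ / twoStar n s * _ - lam * Gv) / 2 - (_ - _ - lam * Gm) + _
  nlinarith [h6, h5]

/-- The energy attains its minimum on all small closed balls. -/
lemma Admissible.eventually_exists_minimizer (h : Admissible s K Ω) (hg : Continuous g)
    (ha₁ : 0 < a₁) (ha₂ : 0 < a₂) (hq : 1 ≤ q) (hqp : q < twoStar n s)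
    (hg1 : ∀ t, |g t| ≤ a₁ + a₂ * |t| ^ (q - 1)) (hμ : 0 < μ) :
    ∀ᶠ ρ : ℝ in 𝓝[>] 0, ∀ lam : ℝ, 0 < lam → ∃ u ∈ X₀ K Ω, normX₀ K Ω u ≤ ρ ∧
      ∀ v ∈ X₀ K Ω, normX₀ K Ω v ≤ ρ →
        energy s K Ω g lam μ u ≤ energy s K Ω g lam μ v := by
  have hp0 := h.twoStar_pos
  filter_upwards [self_mem_nhdsWithin,
    h.eventually_normX₀_sub_sq_le hg ha₁ ha₂ hq hqp hg1 hμ] with ρ hρ Hmid lam hlam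
  have hρ0 : 0 < ρ := hρ
  obtain ⟨A, hA, HA⟩ := h.exists_integral_rpow_le
  obtain ⟨M, hM, HM⟩ := h.exists_abs_integral_primitive_le hg ha₁ ha₂ hq hqp hg1 hρ
  set S := energy s K Ω g lam μ '' {u | u ∈ X₀ K Ω ∧ normX₀ K Ω u ≤ ρ} with hS
  have hbdd : BddBelow S := by
    refine ⟨-(μ / twoStar n s * (A * ρ ^ twoStar n s)) - lam * M, ?_⟩
    rintro _ ⟨u, ⟨hu, huρ⟩, rfl⟩
    have hN := normX₀_nonneg (K := K) (Ω := Ω) u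
    have h1 : μ / twoStar n s * (∫ x in Ω, |u x| ^ twoStar n s) ≤
        μ / twoStar n s * (A * ρ ^ twoStar n s) := by
      have := HA u hu
      have : A * normX₀ K Ω u ^ twoStar n s ≤ A * ρ ^ twoStar n s := by gcongr
      gcongr
      linarith
    have h2 : lam * (∫ x in Ω, primitive g (u x)) ≤ lam * M :=
      mul_le_mul_of_nonneg_left (abs_le.1 (HM u hu huρ)).2 hlam.le
    unfold energy
    nlinarith [sq_nonneg (normX₀ K Ω u)]
  have hne : S.Nonempty := ⟨_, 0, ⟨X₀.zero, by simp [normX₀, hρ0.le]⟩, rfl⟩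
  obtain ⟨e, -, hetend, hemem⟩ := exists_seq_tendsto_sInf hne hbdd
  choose w hw hwe using hemem
  obtain ⟨φ, hφ, u, hae, hL1⟩ := h.exists_subseq_tendsto (fun k => (hw k).1) fun k => (hw k).2
  set z := fun k => w (φ k) with hz
  have hz0 : ∀ k, z k ∈ X₀ K Ω := fun k => (hw _).1
  have hzρ : ∀ k, normX₀ K Ω (z k) ≤ ρ := fun k => (hw _).2
  have hzE : Tendsto (fun k => energy s K Ω g lam μ (z k)) atTop (𝓝 (sInf S)) := by
    have := hetend.comp hφ.tendsto_atTop
    refine this.congr fun k => ?_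
    simp [z, hwe]
  obtain ⟨hu, huρ⟩ := h.mem_X₀_of_tendsto hz0 hρ0.le (Eventually.of_forall hzρ) hae
  -- The midpoint stays in the ball, so its energy is at least the infimum. The energy excess, the
  -- L¹ terms and the error ε cost at most η²/64 each, in total less than η²/16.
  have hcau : ∀ η : ℝ, 0 < η → ∃ N, ∀ j ≥ N, ∀ k ≥ N, normX₀ K Ω (z j - z k) ≤ η := by
    intro η hη
    have hε : 0 < η ^ 2 / (64 * lam) := by positivity
    obtain ⟨C, hC, H⟩ := Hmid lam hlam.le _ hε
    have hE := hzE.eventually_lt_const (show sInf S < sInf S + η ^ 2 / 64 by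
      linarith [sq_pos_of_pos hη])
    have hL : ∀ᶠ k in atTop, lam * (C * ∫ x in Ω, |z k x - u x|) < η ^ 2 / 128 := by
      have h1 := (hL1.const_mul C).const_mul lam
      rw [mul_zero, mul_zero] at h1
      exact h1.eventually_lt_const (by positivity)
    obtain ⟨N, hN⟩ := eventually_atTop.1 (hE.and hL)
    refine ⟨N, fun j hj k hk => ?_⟩
    have h1 := H _ (hz0 j) _ (hz0 k) (hzρ j) (hzρ k)
    have hm : sInf S ≤ energy s K Ω g lam μ ((1 / 2 : ℝ) • (z j + z k)) := by
      refine csInf_le hbdd ⟨_, ⟨X₀.smul (X₀.add (hz0 j) (hz0 k)) _, ?_⟩, rfl⟩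
      rw [normX₀_smul, abs_of_pos (by norm_num)]
      linarith [h.normX₀_add_le (hz0 j) (hz0 k), hzρ j, hzρ k]
    have hi : ∀ k, IntegrableOn (fun x => |z k x - u x|) Ω := fun k =>
      ((h.integrable_of_mem (hz0 k)).sub (h.integrable_of_mem hu)).integrableOn.abs
    have htri : ∫ x in Ω, |z j x - z k x| ≤
        (∫ x in Ω, |z j x - u x|) + ∫ x in Ω, |z k x - u x| := by
      rw [← integral_add (hi j) (hi k)]
      refine integral_mono
        ((h.integrable_of_mem (hz0 j)).sub (h.integrable_of_mem (hz0 k))).integrableOn.abs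
        ((hi j).add (hi k)) fun x => ?_
      have := abs_sub_le (z j x) (u x) (z k x)
      rwa [abs_sub_comm (u x)] at this
    have h2 : lam * (C * (∫ x in Ω, |z j x - z k x|) + η ^ 2 / (64 * lam)) ≤
        lam * (C * (∫ x in Ω, |z j x - u x|)) + lam * (C * ∫ x in Ω, |z k x - u x|) +
          η ^ 2 / 64 := by
      have e1 : lam * (η ^ 2 / (64 * lam)) = η ^ 2 / 64 := by field_simp
      rw [mul_add, e1, ← mul_add, ← mul_add]
      gcongr
    have h3 : normX₀ K Ω (z j - z k) ^ 2 ≤ η ^ 2 := by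
      obtain ⟨b1, b2⟩ := hN j hj
      obtain ⟨b3, b4⟩ := hN k hk
      have h4 := h1.trans (add_le_add_right h2 _)
      have h5 := sq_pos_of_pos hη
      linarith
    exact (sq_le_sq₀ (normX₀_nonneg _) hη.le).1 h3
  have hstrong : Tendsto (fun k => normX₀ K Ω (z k - u)) atTop (𝓝 0) := by
    rw [Metric.tendsto_atTop']
    intro η hη
    obtain ⟨N, hN⟩ := hcau (η / 2) (half_pos hη)
    refine ⟨N, fun j hj => ?_⟩
    have h1 : normX₀ K Ω (z j - u) ≤ η / 2 := by
      -- Fatou in k turns the Cauchy property into norm convergence to the a.e. limit, without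
      -- invoking completeness of `X₀`.
      refine (h.mem_X₀_of_tendsto (w := fun k => z j - z k) (fun k => X₀.sub (hz0 j) (hz0 k))
        (half_pos hη).le ?_ ?_).2
      · filter_upwards [eventually_ge_atTop N] with k hk
        exact hN j hj.le k hk
      · filter_upwards [hae] with x hx
        exact hx.const_sub _
    rw [Real.dist_eq, sub_zero, abs_of_nonneg (normX₀_nonneg _)]
    linarith
  have hEu := h.tendsto_energy (lam := lam) (μ := μ) hg ha₁ ha₂ hq hqp hg1 hρ hz0 hzρ hu huρ
    hstrong hL1
  refine ⟨u, hu, huρ, fun v hv hvρ => ?_⟩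
  rw [tendsto_nhds_unique hEu hzE]
  exact csInf_le hbdd ⟨v, ⟨hv, hvρ⟩, rfl⟩

end Minimization

/-! ### A nontrivial element of `X₀`. -/

section Bump

variable {n : ℕ} {s : ℝ} {K : EuclideanSpace ℝ (Fin n) → ℝ}
  {Ω : Set (EuclideanSpace ℝ (Fin n))}

/-- `Q` is covered by the strips Ω × ℝⁿ and ℝⁿ × Ω; by invariance under translation and reflection
each contributes at most |Ω| ∫ f. -/
lemma setLIntegral_Q_sub_lt_top {f : EuclideanSpace ℝ (Fin n) → ℝ≥0∞} (hf : AEMeasurable f volume)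
    (hfin : ∫⁻ x, f x < ∞) (hΩ : volume Ω < ∞) :
    ∫⁻ p in Q Ω, f (p.1 - p.2) < ∞ := by
  have hsub : Q Ω ⊆ Ω ×ˢ univ ∪ univ ×ˢ Ω := by
    intro p hp
    simp only [Q, mem_compl_iff, mem_prod] at hp
    simp only [mem_union, mem_prod, mem_univ, and_true, true_and]
    tauto
  refine (lintegral_mono_set hsub).trans_lt ((lintegral_union_le _ _ _).trans_lt ?_)
  refine ENNReal.add_lt_top.2 ⟨?_, ?_⟩
  · rw [Measure.volume_eq_prod, ← Measure.prod_restrict, Measure.restrict_univ]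
    refine (lintegral_prod_le _).trans_lt ?_
    simp only [lintegral_sub_left_eq_self f, lintegral_const, Measure.restrict_apply_univ]
    exact ENNReal.mul_lt_top hfin hΩ
  · rw [Measure.volume_eq_prod, ← Measure.prod_restrict, Measure.restrict_univ, lintegral_prod_symm]
    · simp only [lintegral_sub_right_eq_self f, lintegral_const, Measure.restrict_apply_univ]
      exact ENNReal.mul_lt_top hfin hΩ
    · have h1 := hf.comp_quasiMeasurePreserving quasiMeasurePreserving_sub_prod
      have h2 := h1.restrict (s := univ ×ˢ Ω)
      rwa [Measure.volume_eq_prod, ← Measure.prod_restrict, Measure.restrict_univ] at h2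

/-- `X₀` contains a bounded nonnegative function that is not a.e. zero. -/
lemma Admissible.exists_bump (h : Admissible s K Ω) :
    ∃ w ∈ X₀ K Ω, ∃ r : ℝ, 0 < r ∧ (∀ x, 0 ≤ w x ∧ w x ≤ r) ∧ ¬ w =ᵐ[volume] 0 := by
  obtain ⟨x₀, hx₀⟩ := h.nonempty
  obtain ⟨r, hr, hball⟩ := Metric.isOpen_iff.1 h.isOpen x₀ hx₀
  -- A cone suffices: being 1-Lipschitz with oscillation at most r, its squared increments are
  -- dominated by min(|x - y|², 1), the weight that makes K integrable.
  set w : EuclideanSpace ℝ (Fin n) → ℝ := fun x => max 0 (r - dist x x₀) with hw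
  have hwr : ∀ x, 0 ≤ w x ∧ w x ≤ r := fun x =>
    ⟨le_max_left _ _, max_le hr.le (by linarith [dist_nonneg (x := x) (y := x₀)])⟩
  have hwc : Continuous w := by fun_prop
  have hlip : ∀ x y, |w x - w y| ≤ ‖x - y‖ := fun x y => by
    rw [hw]
    simp only [max_comm (0 : ℝ)]
    refine (abs_max_sub_max_le_abs _ _ _).trans ?_
    rw [sub_sub_sub_cancel_left, abs_sub_comm, ← dist_eq_norm]
    exact abs_dist_sub_le _ _ _
  have hosc : ∀ x y, |w x - w y| ≤ r := fun x y =>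
    abs_sub_le_iff.2 ⟨by linarith [hwr x, hwr y], by linarith [hwr x, hwr y]⟩
  have hsq : ∀ x y, (w x - w y) ^ 2 ≤ (1 + r ^ 2) * min (‖x - y‖ ^ 2) 1 := fun x y => by
    rw [← sq_abs]
    rcases min_choice (‖x - y‖ ^ 2) 1 with hmin | hmin <;> rw [hmin]
    · have := pow_le_pow_left₀ (abs_nonneg _) (hlip x y) 2
      nlinarith [mul_nonneg (sq_nonneg r) (sq_nonneg ‖x - y‖)]
    · have := pow_le_pow_left₀ (abs_nonneg _) (hosc x y) 2
      linarith
  have hint := h.integrable.const_mul (1 + r ^ 2)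
  have hfin := setLIntegral_Q_sub_lt_top hint.aestronglyMeasurable.aemeasurable.ennreal_ofReal
    hint.lintegral_lt_top h.volume_lt_top
  have hle : ∫⁻ p in Q Ω, ‖wdiff K w p‖ₑ ^ 2 < ∞ := by
    refine (lintegral_mono fun p => ?_).trans_lt hfin
    dsimp only
    rw [← ofReal_norm, ← ENNReal.ofReal_pow (norm_nonneg _), Real.norm_eq_abs, sq_abs]
    apply ENNReal.ofReal_le_ofReal
    by_cases hp : p.1 = p.2
    · simp [wdiff, hp]
    · have hK := (h.kernel_pos _ (sub_ne_zero.2 hp)).le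
      rw [wdiff, mul_pow, Real.sq_sqrt hK, ← mul_assoc]
      exact mul_le_mul_of_nonneg_right (hsq _ _) hK
  refine ⟨w, h.mem_X₀ hwc.measurable.aemeasurable (ae_of_all _ fun x hx => ?_) ?_, r, hr, hwr, ?_⟩
  · refine max_eq_left (sub_nonpos.2 ?_)
    by_contra! hlt
    exact hx (hball hlt)
  · rw [eLpNorm_eq_lintegral_rpow_enorm_toReal (by norm_num) (by norm_num)]
    refine ENNReal.rpow_lt_top_of_nonneg (by norm_num) ?_
    simpa using hle.ne
  · intro h0
    have h1 := (Continuous.ae_eq_iff_eq volume hwc continuous_const).1 h0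
    have h2 := congrFun h1 x₀
    have h3 : w x₀ = r := by simp [hw, hr.le]
    exact hr.ne' (h3.symm.trans h2)

lemma Admissible.embConst_pos (h : Admissible s K Ω) : 0 < embConst K Ω (twoStar n s) := by
  obtain ⟨w, hw, -, -, -, hw0⟩ := h.exists_bump
  refine ENNReal.toReal_pos (ne_of_gt ?_) h.embConstENN_ne_top
  refine lt_of_lt_of_le ?_ (le_iSup₂ (f := fun u (_ : u ∈ {u | u ∈ X₀ K Ω ∧ ¬ u =ᵐ[volume] 0}) =>
    eLpNorm u (ENNReal.ofReal (twoStar n s)) volume / ENNReal.ofReal (normX₀ K Ω u)) w ⟨hw, hw0⟩)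
  refine ENNReal.div_pos ?_ ENNReal.ofReal_ne_top
  rw [Ne, eLpNorm_eq_zero_iff hw.1.1.aestronglyMeasurable (by simpa using h.twoStar_pos)]
  exact hw0

end Bump

/-! ### Points of negative energy near the origin. -/

section NegativeEnergy

variable {n : ℕ} {s : ℝ} {K : EuclideanSpace ℝ (Fin n) → ℝ}
  {Ω : Set (EuclideanSpace ℝ (Fin n))} {g : ℝ → ℝ} {a₁ a₂ q lam μ : ℝ}

/-- Test with t • w for a bump w and small t > 0: G(tw) dominates any multiple of t²w², and the
critical term only lowers the energy. Nonnegativity of w matters because G is controlled only at 0⁺,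
boundedness because t must work for all x at once. -/
lemma Admissible.exists_energy_neg (h : Admissible s K Ω) (hg : Continuous g)
    (ha₁ : 0 < a₁) (ha₂ : 0 < a₂) (hq : 1 ≤ q) (hqp : q < twoStar n s)
    (hg1 : ∀ t, |g t| ≤ a₁ + a₂ * |t| ^ (q - 1))
    (hg2 : liminf (fun t : ℝ => ((primitive g t / t ^ 2 : ℝ) : EReal)) (𝓝[>] (0 : ℝ)) = ⊤)
    (hμ : 0 < μ) (hlam : 0 < lam) {ρ : ℝ} (hρ : 0 < ρ) :
    ∃ v ∈ X₀ K Ω, normX₀ K Ω v ≤ ρ ∧ energy s K Ω g lam μ v < 0 := by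
  obtain ⟨w, hw, r, hr, hwr, hw0⟩ := h.exists_bump
  have hp0 := h.twoStar_pos
  have hsq : IntegrableOn (fun x => w x ^ 2) Ω := hw.1.2.1.integrable_sq
  set I := ∫ x in Ω, w x ^ 2 with hI
  have hIpos : 0 < I := by
    refine lt_of_le_of_ne (integral_nonneg fun x => sq_nonneg _) fun h0 => hw0 ?_
    have h1 := (integral_eq_zero_iff_of_nonneg (fun x => sq_nonneg (w x)) hsq).1 h0.symm
    rw [Filter.EventuallyEq, ae_restrict_iff' h.measurableSet] at h1
    filter_upwards [h1, hw.2] with x hx hx'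
    by_cases hxΩ : x ∈ Ω
    · simpa using hx hxΩ
    · exact hx' hxΩ
  set N := normX₀ K Ω w with hN
  have hN0 : 0 ≤ N := normX₀_nonneg w
  -- Chosen so that lam · M · I exceeds the quadratic coefficient N²/2 by one.
  set M := (N ^ 2 / 2 + 1) / (lam * I) with hM
  have hev : ∀ᶠ t : ℝ in 𝓝[>] 0, M < primitive g t / t ^ 2 := by
    have h1 : ((M : ℝ) : EReal) <
        liminf (fun t : ℝ => ((primitive g t / t ^ 2 : ℝ) : EReal)) (𝓝[>] (0 : ℝ)) := by
      rw [hg2]; exact EReal.coe_lt_top M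
    filter_upwards [eventually_lt_of_lt_liminf h1] with t ht
    exact_mod_cast ht
  obtain ⟨δ, hδ, hδM⟩ := (nhdsGT_basis (0 : ℝ)).eventually_iff.1 hev
  have hδ0 : 0 < δ := hδ
  obtain ⟨t, ht, htδ, htρ⟩ : ∃ t : ℝ, 0 < t ∧ t * r < δ ∧ t * N ≤ ρ := by
    refine ⟨min (δ / (2 * r)) (ρ / (N + 1)), by positivity, ?_, ?_⟩
    · calc min (δ / (2 * r)) (ρ / (N + 1)) * r ≤ δ / (2 * r) * r := by
            gcongr; exact min_le_left _ _
        _ = δ / 2 := by field_simp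
        _ < δ := by linarith
    · calc min (δ / (2 * r)) (ρ / (N + 1)) * N ≤ ρ / (N + 1) * (N + 1) := by
            gcongr
            · exact min_le_right _ _
            · linarith
        _ = ρ := by field_simp
  have hmem := X₀.smul hw t
  have hnorm : normX₀ K Ω (t • w) = t * N := by rw [normX₀_smul, abs_of_pos ht]
  refine ⟨t • w, hmem, hnorm.trans_le htρ, ?_⟩
  have hG : M * t ^ 2 * I ≤ ∫ x in Ω, primitive g ((t • w) x) := by
    rw [hI, ← integral_const_mul]
    refine integral_mono (hsq.const_mul _)
      (h.integrableOn_primitive hg ha₁ ha₂ hq hqp hg1 hmem) fun x => ?_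
    simp only [Pi.smul_apply, smul_eq_mul]
    rcases (hwr x).1.eq_or_lt with h0 | h0
    · simp [← h0, primitive_zero]
    · have htw : 0 < t * w x := mul_pos ht h0
      have h1 := hδM (x := t * w x) ⟨htw, lt_of_le_of_lt (by gcongr; exact (hwr x).2) htδ⟩
      rw [lt_div_iff₀ (by positivity)] at h1
      nlinarith
  have hJ : 0 ≤ μ / twoStar n s * ∫ x in Ω, |(t • w) x| ^ twoStar n s :=
    mul_nonneg (by positivity) (integral_nonneg fun x => by positivity)
  have h2 : lam * (M * t ^ 2 * I) = (N ^ 2 / 2 + 1) * t ^ 2 := by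
    rw [hM]; field_simp
  have h3 := mul_le_mul_of_nonneg_left hG hlam.le
  have h4 : 0 < t ^ 2 := by positivity
  unfold energy
  rw [hnorm]
  nlinarith

end NegativeEnergy

/-! ### The maximum of `h` and the small radius. -/

section RationalFunction

variable {n : ℕ} {s : ℝ} {K : EuclideanSpace ℝ (Fin n) → ℝ}
  {Ω : Set (EuclideanSpace ℝ (Fin n))} {a₁ a₂ q μ : ℝ}

lemma Admissible.smallRadius_pos (h : Admissible s K Ω) (hμ : 0 < μ) :
    0 < smallRadius s K Ω μ := by
  have hc := h.embConst_pos
  have hn : (0 : ℝ) < n := by exact_mod_cast h.n_pos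
  have h2 : 0 < (n : ℝ) - 2 * s := by linarith [h.two_s_lt]
  unfold smallRadius
  positivity

/-- The numerator is t(1 - c t^{p-2}) with p > 2: positive for small t > 0, nonpositive for large t.
The denominator stays positive, so the search for a maximum reduces to a compact interval. -/
lemma Admissible.exists_isMaxOn_h (h : Admissible s K Ω) (ha₁ : 0 < a₁) (ha₂ : 0 < a₂)
    (hq : 1 ≤ q) (hμ : 0 < μ) :
    ∃ t₀ ∈ Ici (0 : ℝ), IsMaxOn (NonlocalCritical.h s K Ω a₁ a₂ q μ) (Ici 0) t₀ ∧
      0 < NonlocalCritical.h s K Ω a₁ a₂ q μ t₀ := by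
  have hc := h.embConst_pos
  have hp2 := h.two_lt_twoStar
  have hV : 0 < volume.real Ω := ENNReal.toReal_pos
    (h.isOpen.measure_pos volume h.nonempty).ne' h.volume_lt_top.ne
  set p := twoStar n s with hp
  set c := μ * embConst K Ω p ^ p with hcdef
  have hc0 : 0 < c := by positivity
  set D₁ := a₁ * embConst K Ω p * volume.real Ω ^ ((p - 1) / p) with hD₁
  set D₂ := a₂ * embConst K Ω p ^ q * volume.real Ω ^ ((p - q) / p) with hD₂
  have hD₁0 : 0 < D₁ := by positivity
  have hD₂0 : 0 < D₂ := by positivity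
  have hh : ∀ t, NonlocalCritical.h s K Ω a₁ a₂ q μ t =
    (t - c * t ^ (p - 1)) / (D₁ + D₂ * t ^ (q - 1)) := fun t => rfl
  have hden : ∀ t : ℝ, 0 ≤ t → 0 < D₁ + D₂ * t ^ (q - 1) := fun t ht => by positivity
  have hnum : ∀ t : ℝ, 0 < t → t - c * t ^ (p - 1) = t * (1 - c * t ^ (p - 2)) := fun t ht => by
    have : t ^ (p - 1) = t ^ (p - 2) * t := by
      rw [← Real.rpow_add_one ht.ne']; congr 1; ring
    rw [this]; ring
  have hcont : ContinuousOn (NonlocalCritical.h s K Ω a₁ a₂ q μ) (Ici 0) := by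
    rw [funext hh]
    refine ContinuousOn.div ?_ ?_ fun t ht => (hden t ht).ne'
    · exact (continuous_id.sub (continuous_const.mul
        (Real.continuous_rpow_const (by linarith)))).continuousOn
    · exact (continuous_const.add (continuous_const.mul
        (Real.continuous_rpow_const (by linarith)))).continuousOn
  obtain ⟨t₁, ht₁s, ht₁⟩ := ((eventually_mul_rpow_lt (by linarith : 0 < p - 2) c one_pos).and
    self_mem_nhdsWithin).exists
  have ht₁0 : 0 < t₁ := ht₁
  have hpos : 0 < NonlocalCritical.h s K Ω a₁ a₂ q μ t₁ := by
    rw [hh, hnum t₁ ht₁0]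
    exact div_pos (mul_pos ht₁0 (by linarith)) (hden t₁ ht₁0.le)
  have hlarge : ∀ᶠ t in atTop, NonlocalCritical.h s K Ω a₁ a₂ q μ t ≤
      NonlocalCritical.h s K Ω a₁ a₂ q μ t₁ := by
    filter_upwards [(tendsto_rpow_atTop (by linarith : 0 < p - 2)).eventually_ge_atTop c⁻¹,
      eventually_gt_atTop 0] with t ht ht0
    refine le_trans ?_ hpos.le
    rw [hh, hnum t ht0]
    refine div_nonpos_of_nonpos_of_nonneg (mul_nonpos_of_nonneg_of_nonpos ht0.le ?_)
      (hden t ht0.le).le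
    have := mul_le_mul_of_nonneg_left ht hc0.le
    rw [mul_inv_cancel₀ hc0.ne'] at this
    linarith
  -- The cocompact filter has two ends; the one at -∞ does not meet the half-line.
  obtain ⟨t₀, ht₀, hmax⟩ := hcont.exists_isMaxOn' isClosed_Ici (mem_Ici.2 ht₁0.le) (by
    rw [cocompact_eq_atBot_atTop, inf_sup_right, eventually_sup]
    refine ⟨?_, hlarge.filter_mono inf_le_left⟩
    have : ∀ᶠ t : ℝ in atBot ⊓ 𝓟 (Ici 0), False := by
      rw [eventually_inf_principal]
      filter_upwards [eventually_lt_atBot (0 : ℝ)] with t ht ht'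
      exact absurd ht' (not_le.2 ht)
    exact this.mono fun _ hf => hf.elim)
  exact ⟨t₀, ht₀, hmax, hpos.trans_le (hmax (mem_Ici.2 ht₁0.le))⟩

end RationalFunction

/-! ### From interior minimizers to weak solutions. -/

section EulerLagrange

variable {n : ℕ} {s : ℝ} {K : EuclideanSpace ℝ (Fin n) → ℝ}
  {Ω : Set (EuclideanSpace ℝ (Fin n))} {u v : EuclideanSpace ℝ (Fin n) → ℝ}
  {g : ℝ → ℝ} {a₁ a₂ q lam μ : ℝ}

/-- Differentiability along lines of an integral functional with critical growth. -/
lemma Admissible.hasDerivAt_integral_comp (h : Admissible s K Ω) {F f : ℝ → ℝ}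
    (hF : ∀ t, HasDerivAt F (f t) t) (hf : Continuous f) {C : ℝ} (hC : 0 ≤ C)
    (hfC : ∀ t, |f t| ≤ C * (1 + |t| ^ (twoStar n s - 1)))
    (hu : u ∈ X₀ K Ω) (hv : v ∈ X₀ K Ω) (hFu : IntegrableOn (fun x => F (u x)) Ω) :
    IntegrableOn (fun x => f (u x) * v x) Ω ∧
      HasDerivAt (fun t : ℝ => ∫ x in Ω, F ((u + t • v) x)) (∫ x in Ω, f (u x) * v x) 0 := by
  have hp2 := h.two_lt_twoStar
  have hp0 := h.twoStar_pos
  have hum : AEStronglyMeasurable u (volume.restrict Ω) := hu.1.1.aestronglyMeasurable.restrict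
  have hvm : AEStronglyMeasurable v (volume.restrict Ω) := hv.1.1.aestronglyMeasurable.restrict
  have hFc : Continuous F := continuous_iff_continuousAt.2 fun t => (hF t).continuousAt
  have hsum : IntegrableOn (fun x => |(|u x| + |v x|)| ^ twoStar n s) Ω :=
    MemLp.integrable_abs_rpow hp0 ((h.memLp_twoStar hu).norm.add (h.memLp_twoStar hv).norm)
  -- For |t| < 1 one has |u + tv| ≤ |u| + |v|, a function in L^{2^*}(Ω); this gives a majorant
  -- independent of t.
  have key := hasDerivAt_integral_of_dominated_loc_of_deriv_le (μ := volume.restrict Ω)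
    (F := fun t x => F (u x + t * v x)) (F' := fun t x => f (u x + t * v x) * v x) (x₀ := (0 : ℝ))
    (bound := fun x => C * (|v x| + |(|u x| + |v x|)| ^ twoStar n s))
    (Metric.ball_mem_nhds 0 one_pos)
    (Eventually.of_forall fun t => hFc.comp_aestronglyMeasurable (hum.add (hvm.const_mul t)))
    (by simpa [IntegrableOn] using hFu)
    ((hf.comp_aestronglyMeasurable (hum.add (hvm.const_mul 0))).mul hvm)
    (ae_of_all _ fun x t ht => ?_)
    (((h.integrable_of_mem hv).integrableOn.abs.add hsum).const_mul C)
    (ae_of_all _ fun x t _ => ?_)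
  · simpa [IntegrableOn] using key
  · have ht1 : |t| ≤ 1 := by
      rw [Metric.mem_ball, Real.dist_eq, sub_zero] at ht
      exact ht.le
    set m := |u x| + |v x| with hm
    have hm0 : 0 ≤ m := by positivity
    have h1 : |u x + t * v x| ≤ m := by
      refine (abs_add_le _ _).trans ?_
      rw [abs_mul]
      have := mul_le_of_le_one_left (abs_nonneg (v x)) ht1
      linarith
    have h2 : |u x + t * v x| ^ (twoStar n s - 1) ≤ m ^ (twoStar n s - 1) :=
      Real.rpow_le_rpow (abs_nonneg _) h1 (by linarith)
    have h3 : m ^ (twoStar n s - 1) * |v x| ≤ m ^ twoStar n s := by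
      have h4 : m ^ (twoStar n s - 1) * m = m ^ twoStar n s := by
        rcases hm0.eq_or_lt with h0 | h0
        · rw [← h0, mul_zero, Real.zero_rpow hp0.ne']
        · rw [← Real.rpow_add_one h0.ne']; congr 1; ring
      rw [← h4]
      gcongr
      rw [hm]; linarith [abs_nonneg (u x)]
    rw [norm_mul, Real.norm_eq_abs, Real.norm_eq_abs, abs_of_nonneg hm0]
    calc |f (u x + t * v x)| * |v x|
        ≤ C * (1 + m ^ (twoStar n s - 1)) * |v x| := by
          gcongr
          exact (hfC _).trans (by gcongr)
      _ = C * (|v x| + m ^ (twoStar n s - 1) * |v x|) := by ring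
      _ ≤ C * (|v x| + m ^ twoStar n s) := by gcongr
  · have h1 : HasDerivAt (fun t : ℝ => u x + t * v x) (v x) t := by
      simpa using ((hasDerivAt_id t).mul_const (v x)).const_add (u x)
    exact (hF _).comp t h1

/-- A local minimizer of the energy is a weak solution. -/
lemma Admissible.isWeakSolution_of_minimizer (h : Admissible s K Ω) (hg : Continuous g)
    (ha₁ : 0 < a₁) (ha₂ : 0 < a₂) (hq : 1 ≤ q) (hqp : q < twoStar n s)
    (hg1 : ∀ t, |g t| ≤ a₁ + a₂ * |t| ^ (q - 1)) {ρ : ℝ} (hu : u ∈ X₀ K Ω)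
    (huρ : normX₀ K Ω u < ρ)
    (hmin : ∀ v ∈ X₀ K Ω, normX₀ K Ω v ≤ ρ →
      energy s K Ω g lam μ u ≤ energy s K Ω g lam μ v) :
    IsWeakSolution s K Ω g lam μ u := by
  refine ⟨hu, fun v hv => ?_⟩
  have hp2 := h.two_lt_twoStar
  have hp0 := h.twoStar_pos
  obtain ⟨C, hC, HC⟩ := exists_growth_le ha₁ ha₂ hq hqp hg1 one_pos
  have hcont : Continuous fun t : ℝ => |t| ^ (twoStar n s - 2) * t :=
    (continuous_abs.rpow_const fun t => Or.inr (by linarith)).mul continuous_id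
  obtain ⟨hi1, hd1⟩ := h.hasDerivAt_integral_comp
    (F := fun t => |t| ^ twoStar n s) (f := fun t => twoStar n s * (|t| ^ (twoStar n s - 2) * t))
    (fun t => by
      simpa [mul_assoc] using hasDerivAt_abs_rpow t (by linarith : 1 < twoStar n s))
    (continuous_const.mul hcont) hp0.le
    (fun t => by
      rw [abs_mul, abs_mul, abs_of_pos hp0, abs_of_nonneg (Real.rpow_nonneg (abs_nonneg t) _)]
      have : |t| ^ (twoStar n s - 2) * |t| = |t| ^ (twoStar n s - 1) := by
        rcases (abs_nonneg t).eq_or_lt with h0 | h0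
        · rw [← h0, mul_zero, Real.zero_rpow (by linarith)]
        · rw [← Real.rpow_add_one h0.ne']; congr 1; ring
      rw [this]
      gcongr
      linarith) hu hv (h.integrableOn_rpow hu)
  obtain ⟨hi2, hd2⟩ := h.hasDerivAt_integral_comp (F := primitive g) (f := g)
    (hasDerivAt_primitive hg) hg (C := C + 1) (by positivity)
    (fun t => by
      refine (HC t).trans ?_
      have : 0 ≤ |t| ^ (twoStar n s - 1) := by positivity
      nlinarith) hu hv
    (h.integrableOn_primitive hg ha₁ ha₂ hq hqp hg1 hu)
  have e1 : ∫ x in Ω, twoStar n s * (|u x| ^ (twoStar n s - 2) * u x) * v x =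
      twoStar n s * ∫ x in Ω, |u x| ^ (twoStar n s - 2) * u x * v x := by
    rw [← integral_const_mul]
    simp only [mul_assoc]
  have hi1' : IntegrableOn (fun x => |u x| ^ (twoStar n s - 2) * u x * v x) Ω := by
    refine (hi1.const_mul (twoStar n s)⁻¹).congr (ae_of_all _ fun x => ?_)
    simp only [← mul_assoc]
    rw [inv_mul_cancel₀ hp0.ne', one_mul]
  have hmulint : IntegrableOn (fun p : EuclideanSpace ℝ (Fin n) × EuclideanSpace ℝ (Fin n) =>
      (u p.1 - u p.2) * (v p.1 - v p.2) * K (p.1 - p.2)) (Q Ω) := by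
    simp only [h.mul_eq]
    exact X₀.integrable_wdiff_mul hu hv
  refine ⟨hmulint, hi1', hi2, ?_⟩
  have hdN : HasDerivAt (fun t : ℝ => normX₀ K Ω (u + t • v) ^ 2) (2 * scalarProd K Ω u v) 0 := by
    simp only [h.normX₀_add_smul_sq hu hv]
    have h1 : HasDerivAt (fun t : ℝ => normX₀ K Ω u ^ 2 + 2 * t * scalarProd K Ω u v +
        t ^ 2 * normX₀ K Ω v ^ 2) (2 * 1 * scalarProd K Ω u v +
        (2 * 0 ^ (2 - 1) * 1) * normX₀ K Ω v ^ 2) 0 :=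
      ((((hasDerivAt_id (0 : ℝ)).const_mul 2).mul_const (scalarProd K Ω u v)).const_add _).add
        (((hasDerivAt_id (0 : ℝ)).pow 2).mul_const _)
    simpa using h1
  have hdE : HasDerivAt (fun t : ℝ => energy s K Ω g lam μ (u + t • v))
      (1 / 2 * (2 * scalarProd K Ω u v) - μ / twoStar n s *
        (twoStar n s * ∫ x in Ω, |u x| ^ (twoStar n s - 2) * u x * v x) -
        lam * ∫ x in Ω, g (u x) * v x) 0 := by
    rw [e1] at hd1
    exact ((hdN.const_mul _).sub (hd1.const_mul _)).sub (hd2.const_mul _)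
  -- The strict inequality ‖u‖ < ρ keeps u + tv in the ball for small t of either sign.
  have hloc : IsLocalMin (fun t : ℝ => energy s K Ω g lam μ (u + t • v)) 0 := by
    have hcn : ∀ᶠ t : ℝ in 𝓝 0, normX₀ K Ω u + |t| * normX₀ K Ω v < ρ := by
      have : ContinuousAt (fun t : ℝ => normX₀ K Ω u + |t| * normX₀ K Ω v) 0 := by fun_prop
      exact this.eventually_lt_const (by simpa using huρ)
    filter_upwards [hcn] with t ht
    simp only [zero_smul, add_zero]
    refine hmin _ (X₀.add hu (X₀.smul hv t)) ?_
    have := h.normX₀_add_le hu (X₀.smul hv t)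
    rw [normX₀_smul] at this
    linarith
  have h0 := hloc.hasDerivAt_eq_zero hdE
  rw [← h0]
  field_simp

end EulerLagrange

end NonlocalCritical

/-! ### Choice of the radius and of the parameter interval. -/

theorem theorem3p1 {n : ℕ} {s : ℝ} (hs0 : 0 < s) (hs1 : s < 1) (hns : 2 * s < n)
    {Ω : Set (EuclideanSpace ℝ (Fin n))} (hΩo : IsOpen Ω) (hΩb : Bornology.IsBounded Ω)
    (hΩne : Ω.Nonempty)
    {K : EuclideanSpace ℝ (Fin n) → ℝ} (hKpos : ∀ x, x ≠ 0 → 0 < K x)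
    (hk1 : Integrable (fun x => min (‖x‖ ^ 2) 1 * K x) volume)
    (hk2 : ∃ k₀ : ℝ, 0 < k₀ ∧ ∀ x, x ≠ 0 → k₀ / ‖x‖ ^ ((n : ℝ) + 2 * s) ≤ K x)
    {g : ℝ → ℝ} (hg : Continuous g)
    {a₁ a₂ q : ℝ} (ha₁ : 0 < a₁) (ha₂ : 0 < a₂)
    (hq1 : 1 ≤ q) (hq2 : q < NonlocalCritical.twoStar n s)
    (hg1 : ∀ t, |g t| ≤ a₁ + a₂ * |t| ^ (q - 1))
    (hg2 : liminf (fun t : ℝ => ((NonlocalCritical.primitive g t / t ^ 2 : ℝ) : EReal))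
      (𝓝[>] (0 : ℝ)) = ⊤) :
    NonlocalCritical.embConstENN K Ω (NonlocalCritical.twoStar n s) ≠ ∞ ∧
    ∀ μ : ℝ, 0 < μ →
      ∃ t₀ ∈ Ici (0 : ℝ), IsMaxOn (NonlocalCritical.h s K Ω a₁ a₂ q μ) (Ici 0) t₀ ∧
        ∃ a b : ℝ, a < b ∧ Ioo a b ⊆ Ioo 0 (NonlocalCritical.h s K Ω a₁ a₂ q μ t₀) ∧
          ∀ lam ∈ Ioo a b, ∃ u : EuclideanSpace ℝ (Fin n) → ℝ,
            NonlocalCritical.IsWeakSolution s K Ω g lam μ u ∧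
            ¬ u =ᵐ[volume] 0 ∧
            ∃ ρ : ℝ, 0 < ρ ∧ ρ < NonlocalCritical.smallRadius s K Ω μ ∧
              NonlocalCritical.normX₀ K Ω u < ρ ∧
              ∀ v ∈ NonlocalCritical.X₀ K Ω, NonlocalCritical.normX₀ K Ω v ≤ ρ →
                NonlocalCritical.energy s K Ω g lam μ u ≤
                  NonlocalCritical.energy s K Ω g lam μ v := by
  have h : NonlocalCritical.Admissible s K Ω :=
    ⟨hs0, hns, hΩo, hΩb, hΩne, hKpos, hk1, hk2⟩
  refine ⟨h.embConstENN_ne_top, fun μ hμ => ?_⟩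
  obtain ⟨t₀, ht₀, hmax, hpos⟩ := h.exists_isMaxOn_h (q := q) ha₁ ha₂ hq1 hμ
  obtain ⟨A, hA, HA⟩ := h.exists_integral_rpow_le
  have hp0 := h.twoStar_pos
  have hp2 := h.two_lt_twoStar
  -- The radius is fixed before lam: minimizers exist for every lam > 0, and the critical term on
  -- the sphere is at most ρ²/4.
  obtain ⟨ρ, ⟨⟨hρmin, hρA⟩, hρ⟩, hρs⟩ :=
    (((h.eventually_exists_minimizer hg ha₁ ha₂ hq1 hq2 hg1 hμ).and
      (NonlocalCritical.eventually_mul_rpow_lt (sub_pos.2 hp2)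
        (μ / NonlocalCritical.twoStar n s * A) (by norm_num : (0 : ℝ) < 1 / 4))).and
      self_mem_nhdsWithin).and
      ((eventually_lt_nhds (h.smallRadius_pos hμ)).filter_mono nhdsWithin_le_nhds) |>.exists
  have hρ0 : 0 < ρ := hρ
  obtain ⟨M, hM, HM⟩ := h.exists_abs_integral_primitive_le hg ha₁ ha₂ hq1 hq2 hg1 hρ0
  -- The second bound gives lam · M < ρ²/4, so on the sphere the energy exceeds ρ²/2 - ρ²/4 - ρ²/4 =
  -- 0.
  refine ⟨t₀, ht₀, hmax, 0, min (NonlocalCritical.h s K Ω a₁ a₂ q μ t₀) (ρ ^ 2 / (4 * M)),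
    lt_min hpos (by positivity), Ioo_subset_Ioo_right (min_le_left _ _), fun lam hlam => ?_⟩
  have hlam0 : 0 < lam := hlam.1
  have hlamM : lam * M < ρ ^ 2 / 4 := by
    have h1 := hlam.2.trans_le (min_le_right _ _)
    rw [lt_div_iff₀ (by positivity)] at h1
    linarith
  obtain ⟨u, hu, huρ, hmin⟩ := hρmin lam hlam0
  obtain ⟨v, hv, hvρ, hvE⟩ := h.exists_energy_neg hg ha₁ ha₂ hq1 hq2 hg1 hg2 hμ hlam0 hρ0
  have huE := (hmin v hv hvρ).trans_lt hvE
  -- The minimum is negative while the energy on the sphere is positive.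
  have hlt : NonlocalCritical.normX₀ K Ω u < ρ := by
    refine lt_of_le_of_ne huρ fun heq => ?_
    have h1 : μ / NonlocalCritical.twoStar n s *
        (∫ x in Ω, |u x| ^ NonlocalCritical.twoStar n s) ≤ 1 / 4 * ρ ^ 2 := by
      have h2 : ρ ^ NonlocalCritical.twoStar n s =
          ρ ^ (NonlocalCritical.twoStar n s - 2) * ρ ^ 2 := by
        rw [← Real.rpow_two, ← Real.rpow_add hρ0]; congr 1; ring
      have h3 := HA u hu
      rw [heq, h2] at h3
      refine (mul_le_mul_of_nonneg_left h3 (by positivity)).trans ?_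
      rw [← mul_assoc, ← mul_assoc]
      exact mul_le_mul_of_nonneg_right hρA.le (sq_nonneg _)
    have h2 := mul_le_mul_of_nonneg_left (abs_le.1 (HM u hu huρ)).2 hlam0.le
    rw [NonlocalCritical.energy, heq] at huE
    linarith
  refine ⟨u, h.isWeakSolution_of_minimizer hg ha₁ ha₂ hq1 hq2 hg1 hu hlt hmin, fun h0 => ?_, ρ,
    hρ0, hρs, hlt, hmin⟩
  -- If u vanished a.e., its energy would reduce to ½‖u‖² ≥ 0, contradicting negativity.
  have h0' := ae_restrict_of_ae (s := Ω) h0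
  have h1 : ∫ x in Ω, |u x| ^ NonlocalCritical.twoStar n s = 0 :=
    integral_eq_zero_of_ae (h0'.mono fun x hx => by simp [hx, Real.zero_rpow hp0.ne'])
  have h2 : ∫ x in Ω, NonlocalCritical.primitive g (u x) = 0 :=
    integral_eq_zero_of_ae (h0'.mono fun x hx => by simp [hx, NonlocalCritical.primitive_zero])
  rw [NonlocalCritical.energy, h1, h2] at huE
  nlinarith [sq_nonneg (NonlocalCritical.normX₀ K Ω u)]
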